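/- **Setting.** Let $n\in\mathbb N$, let $\mathbb H$ be the quaternions and $\mathbb S=\{J\in\mathbb H: J^2=-1\}$. Let $D\subseteq\mathbb C^n$ be invariant under the conjugation of each single coordinate ($z\mapsto\overline z^h$), and suppose that the axially symmetric set $$\Omega=\Omega_D=\{(\alpha_1+J_1\beta_1,\dots,\alpha_n+J_n\beta_n): (\alpha_1+i\beta_1,\dots,\alpha_n+i\beta_n)\in D,\ J_1,\dots,J_n\in\mathbb S\}\subseteq\mathbb H^n$$ is open. Let $\mathbb R_\bullet=\bigcup_{k=1}^n\{x\in\mathbb H^n: x_k\in\mathbb R\}$ and $D_\bullet=\{z\in D:\operatorname{Im} z_k\ne0\text{ for all }k\}$, so that $\Omega\setminus\mathbb R_\bullet=\Omega_{D_\bullet}$. *Slice functions.* Let $\mathcal P(m)$ be the set of subsets of $\{1,\dots,m\}$ and $(e_K)_{K\in\mathcal P(n)}$ a basis of $\mathbb R^{2^n}$. A stem function on $D$ is $F=\sum_{K}e_KF_K:D\to\mathbb H\otimes\mathbb R^{2^n}$ with $F_K(\overline z^h)=-F_K(z)$ if $h\in K$ and $F_K(\overline z^h)=F_K(z)$ if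 $h\notin K$. It induces the slice function $f=\mathcal I(F)$ on $\Omega$, $f(x)=\sum_KJ_KF_K(z)$ for $x_h=\alpha_h+J_h\beta_h$, $z_h=\alpha_h+i\beta_h$, where $J_K=J_{k_1}\cdots J_{k_p}$ if $K=\{k_1<\dots<k_p\}$. $\mathcal S(\Omega)$ is the set of slice functions on $\Omega$. The slice product of $f=\mathcal I(F)$ and $g=\mathcal I(G)$ is $f\cdot g=\mathcal I(FG)$, with $(a e_H)(b e_K)=(-1)^{|H\cap K|}ab\,e_{H\Delta K}$. Let $\mathcal J_h(ae_K)=ae_{K\cup\{h\}}$ if $h\notin K$ and $\mathcal J_h(ae_K)=-ae_{K\setminus\{h\}}$ if $h\in K$. The slice partial derivatives of $f=\mathcal I(F)$ are $$\frac{\partial f}{\partial x_h}=\mathcal I\Big(\tfrac12\big(\tfrac{\partial F}{\partial\alpha_h}-\mathcal J_h\tfrac{\partial F}{\partial\beta_h}\big)\Big),\qquad \frac{\partial f}{\partial x_h^c}=\mathcal I\Big(\tfrac12\big(\tfrac{\partial F}{\partial\alpha_h}+\mathcal J_h\tfrac{\partial F}{\partial\beta_h}\big)\Big).$$ *Wirtinger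 operators.* Write $x_m=x_{m0}+ix_{m1}+jx_{m2}+kx_{m3}$ and $(e_1,e_2,e_3)=(i,j,k)$ for the imaginary units, and put $$\vartheta_{x_m}=\tfrac12\Big(\tfrac{\partial}{\partial x_{m0}}+(\operatorname{Im}x_m)^{-1}\sum_{i=1}^3x_{mi}\tfrac{\partial}{\partial x_{mi}}\Big),\qquad \overline\vartheta_{x_m}=\tfrac12\Big(\tfrac{\partial}{\partial x_{m0}}-(\operatorname{Im}x_m)^{-1}\sum_{i=1}^3x_{mi}\tfrac{\partial}{\partial x_{mi}}\Big),$$ $$\Gamma_{x_m}=-\tfrac12\sum_{i,j=1}^3e_ie_j\Big(x_{mi}\tfrac{\partial}{\partial x_{mj}}-x_{mj}\tfrac{\partial}{\partial x_{mi}}\Big).$$ Define $\Gamma^0_\emptyset(f)=f$ and, for $1\le m\le n$ and $K\in\mathcal P(m)$, $\Gamma^m_K(f)=(2\operatorname{Im}x_m)^{-1}\Gamma_{x_m}\big(x_m^{\mathbf 1_K(m)}\,\Gamma^{m-1}_{K\setminus\{m\}}(f)\big)$. The Wirtinger operators are $$\theta_m(f)=\sum_{K\in\mathcal P(m-1)}(-\overline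 x)_{K^c}\,\vartheta_{x_m}\Gamma^{m-1}_K(f),\qquad \overline\theta_m(f)=\sum_{K\in\mathcal P(m-1)}(-\overline x)_{K^c}\,\overline\vartheta_{x_m}\Gamma^{m-1}_K(f),$$ with $K^c=\{1,\dots,m-1\}\setminus K$ and $(-\overline x)_H=(-\overline x_{h_1})\cdots(-\overline x_{h_p})$ for $H=\{h_1<\dots<h_p\}$. **Theorem.** 1. Let $f=\mathcal I(F)\in\mathcal S(\Omega)\cap\mathcal C^n(\Omega\setminus\mathbb R_\bullet,\mathbb H)$. Then $F$ is of class $\mathcal C^n$ on $D_\bullet$, and for every $m\in\{1,\dots,n\}$, on $\Omega\setminus\mathbb R_\bullet$, $$\theta_m(f)=\frac{\partial f}{\partial x_m},\qquad \overline\theta_m(f)=\frac{\partial f}{\partial x_m^c};$$ moreover $\theta_m(f),\overline\theta_m(f)\in\mathcal S(\Omega\setminus\mathbb R_\bullet)\cap\mathcal C^0(\Omega\setminus\mathbb R_\bullet,\mathbb H)$. 2. The operators $\theta_1,\dots,\theta_n,\overline\theta_1,\dots,\overline\theta_n$ commute with each other: for every $f\in\mathcal S(\Omega)\cap\mathcal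 C^{\max(n,2)}(\Omega\setminus\mathbb R_\bullet,\mathbb H)$ and all $l,m\in\{1,\dots,n\}$, on $\Omega\setminus\mathbb R_\bullet$, $$\theta_l\theta_m(f)=\theta_m\theta_l(f),\qquad \theta_l\overline\theta_m(f)=\overline\theta_m\theta_l(f),\qquad \overline\theta_l\overline\theta_m(f)=\overline\theta_m\overline\theta_l(f).$$ (For $n\ge2$ this is the class $\mathcal C^n$; for $n=1$ class $\mathcal C^2$ is needed for the compositions to be defined.) 3. For all $f,g\in\mathcal S(\Omega)\cap\mathcal C^n(\Omega\setminus\mathbb R_\bullet,\mathbb H)$ and $m\in\{1,\dots,n\}$, on $\Omega\setminus\mathbb R_\bullet$, $$\theta_m(f\cdot g)=\theta_m(f)\cdot g+f\cdot\theta_m(g),\qquad \overline\theta_m(f\cdot g)=\overline\theta_m(f)\cdot g+f\cdot\overline\theta_m(g).$$ -/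

import Mathlib

open scoped Quaternion

namespace SliceWirtinger

noncomputable section

/-! ### Imaginary units and axially symmetric sets -/

/-- The imaginary units `i, j, k` of the quaternions. -/
def imUnit : Fin 3 → ℍ := ![⟨0, 1, 0, 0⟩, ⟨0, 0, 1, 0⟩, ⟨0, 0, 0, 1⟩]

/-- The real coordinates of the imaginary part of a quaternion. -/
def imCoord (i : Fin 3) (q : ℍ) : ℝ := (![q.imI, q.imJ, q.imK] : Fin 3 → ℝ) i

/-- The sphere of the quaternionic imaginary units. -/
def imSphere : Set ℍ := {J | J * J = -1}

/-- The point `(α₁ + J₁ β₁, …, αₙ + Jₙ βₙ)` for `z = (α₁ + i β₁, …, αₙ + i βₙ)`. -/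
def slicePoint {n : ℕ} (z : Fin n → ℂ) (J : Fin n → ℍ) : Fin n → ℍ :=
  fun h => ((z h).re : ℍ) + J h * ((z h).im : ℍ)

/-- Complex conjugation of the `h`-th coordinate. -/
def conjAt {n : ℕ} (h : Fin n) (z : Fin n → ℂ) : Fin n → ℂ :=
  Function.update z h (star (z h))

/-- Invariance of `D ⊆ ℂⁿ` under the conjugations of the single coordinates. -/
def ConjInvariant {n : ℕ} (D : Set (Fin n → ℂ)) : Prop :=
  ∀ z ∈ D, ∀ h, conjAt h z ∈ D

/-- The axially symmetric subset `Ω_D` of `ℍⁿ` associated with `D ⊆ ℂⁿ`. -/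
def circularSet {n : ℕ} (D : Set (Fin n → ℂ)) : Set (Fin n → ℍ) :=
  {x | ∃ z ∈ D, ∃ J : Fin n → ℍ, (∀ h, J h ∈ imSphere) ∧ x = slicePoint z J}

/-- The set `ℝ_•` of the points of `ℍⁿ` with at least one real coordinate. -/
def realLocus (n : ℕ) : Set (Fin n → ℍ) := {x | ∃ k, (x k).im = 0}

/-- The points of `D` with no real coordinate. -/
def offReal {n : ℕ} (D : Set (Fin n → ℂ)) : Set (Fin n → ℂ) := {z ∈ D | ∀ k, (z k).im ≠ 0}

/-- The product `J_{k₁} ⋯ J_{k_p}` for `K = {k₁ < ⋯ < k_p}`, in this order. -/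
def ordProd {n : ℕ} (J : Fin n → ℍ) (K : Finset (Fin n)) : ℍ :=
  ((K.sort (fun a b => a ≤ b)).map J).prod

/-! ### Stem functions and slice functions

An element `∑_K e_K a_K` of `ℍ ⊗ ℝ^{2ⁿ}` is represented by the family `K ↦ a_K`. -/

/-- `F` is a stem function on `D`. -/
def IsStem {n : ℕ} (D : Set (Fin n → ℂ)) (F : (Fin n → ℂ) → Finset (Fin n) → ℍ) : Prop :=
  ∀ z ∈ D, ∀ K, ∀ h, F (conjAt h z) K = if h ∈ K then -F z K else F z K

/-- `f` is induced on `Ω_D` by `F`, that is, `f = 𝓘(F)` on `Ω_D`. -/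
def IsInduced {n : ℕ} (D : Set (Fin n → ℂ)) (F : (Fin n → ℂ) → Finset (Fin n) → ℍ)
    (f : (Fin n → ℍ) → ℍ) : Prop :=
  ∀ z ∈ D, ∀ J : Fin n → ℍ, (∀ h, J h ∈ imSphere) → f (slicePoint z J) = ∑ K, ordProd J K * F z K

/-- `f` is a slice function on `Ω_D`. -/
def IsSlice {n : ℕ} (D : Set (Fin n → ℂ)) (f : (Fin n → ℍ) → ℍ) : Prop :=
  ∃ F, IsStem D F ∧ IsInduced D F f

open Classical in
/-- The stem function inducing the slice function `f` on `Ω_D`; by `stem_unique` it is uniquely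
determined on `D`. -/
def stemOf {n : ℕ} (D : Set (Fin n → ℂ)) (f : (Fin n → ℍ) → ℍ) :
    (Fin n → ℂ) → Finset (Fin n) → ℍ :=
  if h : IsSlice D f then h.choose else 0

/-- The complex coordinate `α + i β`, `β ≥ 0`, of the quaternion `α + J β`. -/
def complexCoord (q : ℍ) : ℂ := ⟨q.re, ‖q.im‖⟩

open Classical in
/-- An imaginary unit `J` with `q = α + J β` and `β ≥ 0`. -/
def sliceUnit (q : ℍ) : ℍ := if q.im = 0 then imUnit 0 else (‖q.im‖⁻¹ : ℝ) • q.im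

/-- The slice function `𝓘(F)` induced by a stem function `F`; by `isInduced_induce` its value at
`α + J β` does not depend on the choice of the representation of the point. -/
def induce {n : ℕ} (F : (Fin n → ℂ) → Finset (Fin n) → ℍ) : (Fin n → ℍ) → ℍ :=
  fun x => ∑ K, ordProd (fun h => sliceUnit (x h)) K * F (fun h => complexCoord (x h)) K

/-- The product of `ℍ ⊗ ℝ^{2ⁿ}`: `(a e_H) (b e_K) = (-1)^{|H ∩ K|} a b e_{H Δ K}`. -/
def tensorMul {n : ℕ} (u v : Finset (Fin n) → ℍ) : Finset (Fin n) → ℍ :=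
  fun L => ∑ H, ∑ K, if symmDiff H K = L then (-1) ^ (H ∩ K).card * (u H * v K) else 0

/-- The slice product `f · g = 𝓘(F G)` of the slice functions `f = 𝓘(F)`, `g = 𝓘(G)` on `Ω_D`. -/
def sliceMul {n : ℕ} (D : Set (Fin n → ℂ)) (f g : (Fin n → ℍ) → ℍ) : (Fin n → ℍ) → ℍ :=
  induce fun z => tensorMul (stemOf D f z) (stemOf D g z)

/-- The complex structure `𝓙_h`: `𝓙_h e_K = e_{K ∪ {h}}` if `h ∉ K` and
`𝓙_h e_K = -e_{K ∖ {h}}` if `h ∈ K`. -/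
def complexStr {n : ℕ} (h : Fin n) (v : Finset (Fin n) → ℍ) : Finset (Fin n) → ℍ :=
  fun K => if h ∈ K then v (K.erase h) else -v (insert h K)

/-- The Cauchy-Riemann operator `∂_h = ½ (∂/∂α_h - 𝓙_h ∂/∂β_h)`. -/
def stemDel {n : ℕ} (h : Fin n) (F : (Fin n → ℂ) → Finset (Fin n) → ℍ) :
    (Fin n → ℂ) → Finset (Fin n) → ℍ := fun z K =>
  (1 / 2 : ℝ) • (fderiv ℝ (fun w => F w K) z (Pi.single h 1) -
    complexStr h (fun H => fderiv ℝ (fun w => F w H) z (Pi.single h Complex.I)) K)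

/-- The Cauchy-Riemann operator `∂̄_h = ½ (∂/∂α_h + 𝓙_h ∂/∂β_h)`. -/
def stemDelBar {n : ℕ} (h : Fin n) (F : (Fin n → ℂ) → Finset (Fin n) → ℍ) :
    (Fin n → ℂ) → Finset (Fin n) → ℍ := fun z K =>
  (1 / 2 : ℝ) • (fderiv ℝ (fun w => F w K) z (Pi.single h 1) +
    complexStr h (fun H => fderiv ℝ (fun w => F w H) z (Pi.single h Complex.I)) K)

/-- The slice partial derivative `∂f/∂x_h = 𝓘(∂_h F)` of `f = 𝓘(F)` on `Ω_D`. -/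
def slicePartial {n : ℕ} (D : Set (Fin n → ℂ)) (h : Fin n) (f : (Fin n → ℍ) → ℍ) :
    (Fin n → ℍ) → ℍ := induce (stemDel h (stemOf D f))

/-- The slice partial derivative `∂f/∂x_h^c = 𝓘(∂̄_h F)` of `f = 𝓘(F)` on `Ω_D`. -/
def slicePartialConj {n : ℕ} (D : Set (Fin n → ℂ)) (h : Fin n) (f : (Fin n → ℍ) → ℍ) :
    (Fin n → ℍ) → ℍ := induce (stemDelBar h (stemOf D f))

/-! ### Wirtinger operators -/

/-- The partial derivative of `f` in the direction `u` of the quaternionic variable `x_m`. -/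
def partialD {n : ℕ} (m : Fin n) (u : ℍ) (f : (Fin n → ℍ) → ℍ) : (Fin n → ℍ) → ℍ :=
  fun x => fderiv ℝ f x (Pi.single m u)

/-- The Euler operator in the imaginary part of `x_m`. -/
def eulerIm {n : ℕ} (m : Fin n) (f : (Fin n → ℍ) → ℍ) : (Fin n → ℍ) → ℍ :=
  fun x => ∑ i, imCoord i (x m) • partialD m (imUnit i) f x

/-- The operator `ϑ_{x_m} = ½ (∂/∂x_{m0} + Im(x_m)⁻¹ 𝔼_{x_m})`. -/
def globalD {n : ℕ} (m : Fin n) (f : (Fin n → ℍ) → ℍ) : (Fin n → ℍ) → ℍ :=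
  fun x => (1 / 2 : ℝ) • (partialD m 1 f x + (x m).im⁻¹ * eulerIm m f x)

/-- The operator `ϑ̄_{x_m} = ½ (∂/∂x_{m0} - Im(x_m)⁻¹ 𝔼_{x_m})`. -/
def globalDBar {n : ℕ} (m : Fin n) (f : (Fin n → ℍ) → ℍ) : (Fin n → ℍ) → ℍ :=
  fun x => (1 / 2 : ℝ) • (partialD m 1 f x - (x m).im⁻¹ * eulerIm m f x)

/-- The operator `L^m_{ij} = x_{mi} ∂/∂x_{mj} - x_{mj} ∂/∂x_{mi}`. -/
def tangentialD {n : ℕ} (m : Fin n) (i j : Fin 3) (f : (Fin n → ℍ) → ℍ) : (Fin n → ℍ) → ℍ :=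
  fun x => imCoord i (x m) • partialD m (imUnit j) f x - imCoord j (x m) • partialD m (imUnit i) f x

/-- The spherical Dirac operator `Γ_{x_m} = -½ ∑_{i,j} e_i e_j L^m_{ij}`. -/
def sphericalDirac {n : ℕ} (m : Fin n) (f : (Fin n → ℍ) → ℍ) : (Fin n → ℍ) → ℍ :=
  fun x => (-(1 / 2) : ℝ) • ∑ i, ∑ j, imUnit i * imUnit j * tangentialD m i j f x

/-- The functions `Γ^m_K(f)`, `m ≤ n`, `K ⊆ {1, …, m}`. The variables are numbered from `0` here,
so that the `m` first ones are those with index `< m`. -/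
def gammaIter {n : ℕ} (f : (Fin n → ℍ) → ℍ) : ℕ → Finset (Fin n) → (Fin n → ℍ) → ℍ
  | 0, _ => f
  | m + 1, K => if h : m < n then fun x =>
      (2 * (x ⟨m, h⟩).im)⁻¹ * sphericalDirac ⟨m, h⟩
        (fun y => (if ⟨m, h⟩ ∈ K then y ⟨m, h⟩ else 1) * gammaIter f m (K.erase ⟨m, h⟩) y) x
    else 0

/-- The Wirtinger operator `θ_m(f) = ∑_{K ∈ 𝒫(m-1)} (-x̄)_{K^c} ϑ_{x_m} Γ^{m-1}_K(f)`, where `K^c` is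
the complement in the set of the indices preceding `m`. -/
def theta {n : ℕ} (m : Fin n) (f : (Fin n → ℍ) → ℍ) : (Fin n → ℍ) → ℍ :=
  fun x => ∑ K ∈ (Finset.Iio m).powerset,
    ordProd (fun k => -star (x k)) (Finset.Iio m \ K) * globalD m (gammaIter f m K) x

/-- The Wirtinger operator `θ̄_m(f) = ∑_{K ∈ 𝒫(m-1)} (-x̄)_{K^c} ϑ̄_{x_m} Γ^{m-1}_K(f)`. -/
def thetaBar {n : ℕ} (m : Fin n) (f : (Fin n → ℍ) → ℍ) : (Fin n → ℍ) → ℍ :=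
  fun x => ∑ K ∈ (Finset.Iio m).powerset,
    ordProd (fun k => -star (x k)) (Finset.Iio m \ K) * globalDBar m (gammaIter f m K) x

/-! ### The definitions are consistent -/

lemma ordProd_smul {n : ℕ} (ε : Fin n → ℝ) (J : Fin n → ℍ) (K : Finset (Fin n)) :
    ordProd (fun k => ε k • J k) K = (∏ k ∈ K, ε k) • ordProd J K := by
  have key : ∀ l : List (Fin n),
      (l.map fun k => ε k • J k).prod = (l.map ε).prod • (l.map J).prod := by
    intro l
    induction l with
    | nil => simp
    | cons a l ih => simp [ih, smul_smul, mul_comm]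
  have h2 : ((K.sort (fun a b => a ≤ b)).map ε).prod = ∏ k ∈ K, ε k := by
    rw [← List.prod_toFinset _ (Finset.sort_nodup _ _), Finset.sort_toFinset]
  rw [ordProd, key, h2, ordProd]

lemma ordProd_congr {n : ℕ} {J J' : Fin n → ℍ} {K : Finset (Fin n)} (h : ∀ k ∈ K, J k = J' k) :
    ordProd J K = ordProd J' K := by
  unfold ordProd
  congr 1
  exact List.map_congr_left fun k hk => h k (by simpa using hk)

lemma imSphere_re {J : ℍ} (h : J ∈ imSphere) : J.re = 0 := by
  have h : J * J = -1 := h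
  have h0 := congrArg (fun q : ℍ => q.re) h
  have h1 := congrArg (fun q : ℍ => q.imI) h
  have h2 := congrArg (fun q : ℍ => q.imJ) h
  have h3 := congrArg (fun q : ℍ => q.imK) h
  simp at h0 h1 h2 h3
  by_contra hne
  have e1 : J.imI = 0 := by
    have : J.re * J.imI = 0 := by linarith
    simpa [hne] using this
  have e2 : J.imJ = 0 := by
    have : J.re * J.imJ = 0 := by linarith
    simpa [hne] using this
  have e3 : J.imK = 0 := by
    have : J.re * J.imK = 0 := by linarith
    simpa [hne] using this
  rw [e1, e2, e3] at h0
  nlinarith [mul_self_nonneg J.re]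

lemma imSphere_norm {J : ℍ} (h : J ∈ imSphere) : ‖J‖ = 1 := by
  have h : J * J = -1 := h
  have h1 : ‖J‖ * ‖J‖ = 1 := by rw [← norm_mul, h, norm_neg, norm_one]
  nlinarith [norm_nonneg J]

lemma neg_mem_imSphere {J : ℍ} (h : J ∈ imSphere) : -J ∈ imSphere := by
  have h : J * J = -1 := h
  simpa [imSphere] using h

lemma slicePoint_re {n : ℕ} (z : Fin n → ℂ) {J : Fin n → ℍ} {h : Fin n} (hJ : J h ∈ imSphere) :
    (slicePoint z J h).re = (z h).re := by
  simp [slicePoint, imSphere_re hJ]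

lemma slicePoint_im {n : ℕ} (z : Fin n → ℂ) {J : Fin n → ℍ} {h : Fin n} (hJ : J h ∈ imSphere) :
    (slicePoint z J h).im = (z h).im • J h := by
  ext <;> simp [slicePoint, imSphere_re hJ, mul_comm]

lemma conjAt_conjAt {n : ℕ} (h : Fin n) (z : Fin n → ℂ) : conjAt h (conjAt h z) = z := by
  simp [conjAt]

lemma stem_flip {n : ℕ} {D : Set (Fin n → ℂ)} (hD : ConjInvariant D)
    {F : (Fin n → ℂ) → Finset (Fin n) → ℍ} (hF : IsStem D F) {z : Fin n → ℂ} (hz : z ∈ D)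
    (S : Finset (Fin n)) :
    (fun k => if k ∈ S then star (z k) else z k) ∈ D ∧
    ∀ K, F (fun k => if k ∈ S then star (z k) else z k) K =
      (∏ k ∈ K, if k ∈ S then (-1 : ℝ) else 1) • F z K := by
  induction S using Finset.induction_on with
  | empty => simpa using hz
  | insert a S ha ih =>
    have e : (fun k => if k ∈ insert a S then star (z k) else z k) =
        conjAt a (fun k => if k ∈ S then star (z k) else z k) := by
      funext k
      by_cases hk : k = a
      · subst hk; simp [conjAt, ha]
      · simp [conjAt, hk]
    rw [e]
    refine ⟨hD _ ih.1 a, fun K => ?_⟩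
    rw [hF _ ih.1, ih.2 K]
    have h1 : ∀ k, (if k ∈ insert a S then (-1 : ℝ) else 1) =
        (if k = a then -1 else 1) * (if k ∈ S then -1 else 1) := by
      intro k
      by_cases hk : k = a
      · subst hk; simp [ha]
      · simp [hk]
    simp only [h1, Finset.prod_mul_distrib, Finset.prod_ite_eq']
    split_ifs <;> simp

/-- A stem function `F` on `D` induces the well-defined function `𝓘(F)` on `Ω_D`. -/
theorem isInduced_induce {n : ℕ} {D : Set (Fin n → ℂ)} (hD : ConjInvariant D)
    {F : (Fin n → ℂ) → Finset (Fin n) → ℍ} (hF : IsStem D F) : IsInduced D F (induce F) := by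
  intro z hz J hJ
  unfold induce
  refine Finset.sum_congr rfl fun K _ => ?_
  set S : Finset (Fin n) := Finset.univ.filter fun k => (z k).im < 0 with hS
  have hc : (fun h => complexCoord (slicePoint z J h)) =
      fun k => if k ∈ S then star (z k) else z k := by
    funext k
    have hn : ‖(slicePoint z J k).im‖ = |(z k).im| := by
      rw [slicePoint_im z (hJ k), norm_smul, imSphere_norm (hJ k), mul_one, Real.norm_eq_abs]
    have hr := slicePoint_re z (hJ k)
    by_cases hk : (z k).im < 0
    · apply Complex.ext <;> simp [complexCoord, hS, hk, hn, hr, abs_of_neg]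
    · apply Complex.ext <;> simp [complexCoord, hS, hk, hn, hr, abs_of_nonneg (not_lt.1 hk)]
  rw [hc, (stem_flip hD hF hz S).2 K]
  by_cases hK : ∃ k ∈ K, (z k).im = 0
  · obtain ⟨k, hk, h0⟩ := hK
    have e : conjAt k z = z := by
      have : star (z k) = z k := by apply Complex.ext <;> simp [h0]
      simp only [conjAt, this, Function.update_eq_self]
    have h2 := hF z hz K k
    rw [e, if_pos hk] at h2
    have : F z K = 0 := by
      have h3 : (2 : ℝ) • F z K = 0 := by
        rw [two_smul]
        nth_rewrite 1 [h2]
        exact neg_add_cancel _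
      exact (smul_eq_zero.1 h3).resolve_left two_ne_zero
    simp [this]
  · push Not at hK
    have h1 : ordProd (fun h => sliceUnit (slicePoint z J h)) K =
        ordProd (fun k => (if k ∈ S then (-1 : ℝ) else 1) • J k) K := by
      refine ordProd_congr fun k hk => ?_
      have hne := hK k hk
      have hJ0 : J k ≠ 0 := by
        intro h; have := imSphere_norm (hJ k); simp [h] at this
      have him : (slicePoint z J k).im ≠ 0 := by
        rw [slicePoint_im z (hJ k)]; exact smul_ne_zero hne hJ0
      rw [sliceUnit, if_neg him, slicePoint_im z (hJ k), norm_smul, imSphere_norm (hJ k), mul_one,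
        Real.norm_eq_abs, smul_smul]
      congr 1
      by_cases hk : (z k).im < 0
      · simp [hS, hk, abs_of_neg, hne]
      · simp [hS, hk, abs_of_nonneg (not_lt.1 hk), hne]
    rw [h1, ordProd_smul, smul_mul_smul_comm, ← Finset.prod_mul_distrib]
    have : ∀ k, (if k ∈ S then (-1 : ℝ) else 1) * (if k ∈ S then (-1 : ℝ) else 1) = 1 := by
      intro k; split_ifs <;> simp
    simp [this]

lemma induce_isSlice {n : ℕ} {D : Set (Fin n → ℂ)} (hD : ConjInvariant D)
    {F : (Fin n → ℂ) → Finset (Fin n) → ℍ} (hF : IsStem D F) : IsSlice D (induce F) :=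
  ⟨F, hF, isInduced_induce hD hF⟩

/-- The inducing stem function is unique. -/
theorem stem_unique {n : ℕ} {D : Set (Fin n → ℂ)}
    {F G : (Fin n → ℂ) → Finset (Fin n) → ℍ} {f : (Fin n → ℍ) → ℍ}
    (hF : IsInduced D F f) (hG : IsInduced D G f) {z : Fin n → ℂ} (hz : z ∈ D) : F z = G z := by
  have hI : imUnit 0 ∈ imSphere := by
    change imUnit 0 * imUnit 0 = -1
    have e : imUnit 0 = (⟨0, 1, 0, 0⟩ : ℍ) := rfl
    rw [e]
    refine (QuaternionAlgebra.mk_mul_mk ..).trans ?_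
    apply QuaternionAlgebra.ext <;> simp
  set c : Finset (Fin n) → ℍ := fun K => ordProd (fun _ => imUnit 0) K * (F z K - G z K) with hc
  have h0 : ∀ S : Finset (Fin n), ∑ K, (∏ k ∈ K, if k ∈ S then (-1 : ℝ) else 1) • c K = 0 := by
    intro S
    set ε : Fin n → ℝ := fun k => if k ∈ S then (-1 : ℝ) else 1
    have hJ : ∀ h, ε h • imUnit 0 ∈ imSphere := by
      intro h
      by_cases hh : h ∈ S
      · simpa [ε, hh] using neg_mem_imSphere hI
      · simpa [ε, hh] using hI
    have := (hF z hz (fun h => ε h • imUnit 0) hJ).symm.trans (hG z hz _ hJ)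
    rw [← sub_eq_zero, ← Finset.sum_sub_distrib] at this
    rw [← this]
    refine Finset.sum_congr rfl fun K _ => ?_
    rw [ordProd_smul ε (fun _ => imUnit 0), ← mul_sub, hc, smul_mul_assoc]
  have hcz : ∀ L, c L = 0 := by
    intro L
    have h1 : ∑ S : Finset (Fin n), (∏ k ∈ L, if k ∈ S then (-1 : ℝ) else 1) •
        ∑ K, (∏ k ∈ K, if k ∈ S then (-1 : ℝ) else 1) • c K = 0 :=
      Finset.sum_eq_zero fun S _ => by rw [h0 S, smul_zero]
    simp only [Finset.smul_sum, smul_smul] at h1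
    rw [Finset.sum_comm] at h1
    simp only [← Finset.sum_smul] at h1
    have horth : ∀ K : Finset (Fin n), ∑ S : Finset (Fin n),
        (∏ k ∈ L, if k ∈ S then (-1 : ℝ) else 1) * (∏ k ∈ K, if k ∈ S then (-1 : ℝ) else 1) =
        if K = L then 2 ^ n else 0 := by
      intro K
      have e1 : ∀ S : Finset (Fin n),
          (∏ k ∈ L, if k ∈ S then (-1 : ℝ) else 1) * (∏ k ∈ K, if k ∈ S then (-1 : ℝ) else 1) =
          (∏ k ∈ S, ((if k ∈ L then (-1 : ℝ) else 1) * (if k ∈ K then (-1 : ℝ) else 1))) := by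
        intro S
        have sw : ∀ A B : Finset (Fin n), (∏ k ∈ A, if k ∈ B then (-1 : ℝ) else 1) =
            ∏ k ∈ B, if k ∈ A then (-1 : ℝ) else 1 := by
          intro A B
          rw [Finset.prod_ite_mem, Finset.prod_ite_mem, Finset.inter_comm]
        rw [sw L S, sw K S, Finset.prod_mul_distrib]
      simp only [e1]
      rw [← Finset.powerset_univ, ← Finset.prod_one_add]
      split_ifs with hKL
      · subst hKL
        have : ∀ k : Fin n, 1 + (if k ∈ K then (-1 : ℝ) else 1) * (if k ∈ K then (-1 : ℝ) else 1)
            = 2 := by intro k; split_ifs <;> norm_num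
        rw [Finset.prod_congr rfl fun k _ => this k]
        simp
      · obtain ⟨a, ha⟩ : ∃ a, ¬(a ∈ K ↔ a ∈ L) := by
          by_contra hcon
          push Not at hcon
          exact hKL (Finset.ext hcon)
        refine Finset.prod_eq_zero (Finset.mem_univ a) ?_
        by_cases h1 : a ∈ K <;> by_cases h2 : a ∈ L <;> simp_all
    simp only [horth, ite_smul, zero_smul, Finset.sum_ite_eq', Finset.mem_univ, if_true] at h1
    exact (smul_eq_zero.1 h1).resolve_left (by positivity)
  funext K
  have hne : ordProd (fun _ : Fin n => imUnit 0) K ≠ 0 := by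
    have : imUnit 0 ≠ 0 := by
      intro h; have := imSphere_norm hI; simp [h] at this
    simp [ordProd, this]
  have := hcz K
  simp only [hc, mul_eq_zero, hne, false_or] at this
  exact sub_eq_zero.1 this

/-- Removing the points with a real coordinate from `D` and from `Ω_D` amounts to the same. -/
theorem circularSet_offReal {n : ℕ} (D : Set (Fin n → ℂ)) :
    circularSet (offReal D) = circularSet D \ realLocus n := by
  have key : ∀ (z : Fin n → ℂ) (J : Fin n → ℍ), (∀ h, J h ∈ imSphere) →
      ∀ k, (slicePoint z J k).im = 0 ↔ (z k).im = 0 := by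
    intro z J hJ k
    have hJ0 : J k ≠ 0 := by
      intro h; have := imSphere_norm (hJ k); simp [h] at this
    rw [slicePoint_im z (hJ k), smul_eq_zero]
    simp [hJ0]
  ext x
  constructor
  · rintro ⟨z, hz, J, hJ, rfl⟩
    refine ⟨⟨z, hz.1, J, hJ, rfl⟩, ?_⟩
    rintro ⟨k, hk⟩
    exact hz.2 k ((key z J hJ k).1 hk)
  · rintro ⟨⟨z, hz, J, hJ, rfl⟩, hx⟩
    refine ⟨z, ⟨hz, fun k hk => hx ⟨k, (key z J hJ k).2 hk⟩⟩, J, hJ, rfl⟩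

end

end SliceWirtinger

namespace SliceWirtinger

noncomputable section

/-! ### Ordered products and sums over subsets -/

/-! Off the real locus every point has smooth polar coordinates `z = complexCoord x`, `J = sliceUnit
x`, and a slice function is `x ↦ evalAt J (F z)`. The proof moves every operator on functions to an
algebraic or Cauchy-Riemann operator on stems.

The obstruction is noncommutativity: an operator in `x_m` multiplies from the left by `J m`, but in
`J_K` the factor `J m` is preceded by the units of smaller index. If the stem has no component
meeting the indices below `m` (`SupportedFrom`), then `J m` is the leftmost factor, the function has
the form `a + J m * b` with `a`, `b` free of `J m`, and left multiplication by `J m` is the complex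
structure `complexStr m`. On such functions `ϑ_{x_m}` is the Cauchy-Riemann operator on the stem
(`globalCR_induce`). The operator `(2 Im x_m)⁻¹ Γ_{x_m}` annihilates functions of `Re x_m` and `|Im
x_m|` and differentiates only the unit `J m`, so it extracts the spherical derivative `b / |Im x_m|`
(`sphericalDirac_induce`), which no longer involves the index `m`. By induction `Γ^m_K f` is induced
by `gammaVec`, an algebraic expression in `F` containing no derivative of `F` and supported from
`m`.

The sum defining `θ_m` undoes these extractions: for each `h < m`, `v = (x_h v)' - x̄_h v'`, where
the prime is the spherical derivative in `x_h` (`evalAt_reconstruct`), and iteration gives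
`evalAt_eq_sum_gammaVec`. The Cauchy-Riemann operator in `z_m` commutes with the operations in
`z_h`, `h ≠ m` (`stemCR_gammaVec`), so reconstruction can be applied to the stem `stemCR ε m F`.
This gives `thetaCR_eqOn`, with `ε = 1` for `θ_m` and `ε = -1` for `θ̄_m`.

The rest is a statement about stems. Commutation follows from the symmetry of second derivatives and
the commuting of the complex structures (`stemCR_comm`). The Leibniz rule holds because the product
is bilinear over every complex structure (`stemCR_tensorMul`). Regularity of `F` comes from
recovering its components by averaging `f` over sign changes of the units
(`IsInduced.contDiffOn_stem`). -/

lemma ordProd_insert_of_lt {n : ℕ} (J : Fin n → ℍ) {m : Fin n} {K : Finset (Fin n)}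
    (h : ∀ k ∈ K, m < k) : ordProd J (insert m K) = J m * ordProd J K := by
  have hm : m ∉ K := fun hm => lt_irrefl m (h m hm)
  have := Finset.sort_insert (fun a b : Fin n => a ≤ b) (fun b hb => (h b hb).le) hm
  simp only [ordProd, this, List.map_cons, List.prod_cons]

lemma ordProd_insert_of_gt {n : ℕ} (J : Fin n → ℍ) {m : Fin n} {K : Finset (Fin n)}
    (h : ∀ k ∈ K, k < m) : ordProd J (insert m K) = ordProd J K * J m := by
  have hm : m ∉ K := fun hm => lt_irrefl m (h m hm)
  have hs : (insert m K).sort (fun a b => a ≤ b) = K.sort (fun a b => a ≤ b) ++ [m] := by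
    refine List.Perm.eq_of_pairwise (le := fun a b : Fin n => a ≤ b) ?_
      (Finset.pairwise_sort _ _) ?_ ?_
    · intro a b _ _ h1 h2
      exact le_antisymm h1 h2
    · rw [List.pairwise_append]
      refine ⟨Finset.pairwise_sort _ _, by simp, ?_⟩
      intro a ha b hb
      simp only [List.mem_singleton] at hb
      subst hb
      exact (h a (by simpa using ha)).le
    · refine (List.perm_ext_iff_of_nodup (Finset.sort_nodup _ _) ?_).2 ?_
      · refine List.Nodup.append (Finset.sort_nodup _ _) (by simp) ?_
        simpa using hm
      · intro a
        simp [or_comm]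
  simp [ordProd, hs]

lemma ordProd_empty {n : ℕ} (J : Fin n → ℍ) : ordProd J ∅ = 1 := by
  simp [ordProd]

lemma sum_finset_split {n : ℕ} {M : Type*} [AddCommMonoid M] (m : Fin n)
    (φ : Finset (Fin n) → M) :
    ∑ K, φ K = ∑ K ∈ (Finset.univ.erase m).powerset, (φ K + φ (insert m K)) := by
  rw [Finset.sum_add_distrib, ← Finset.sum_powerset_insert (Finset.notMem_erase _ _),
    Finset.insert_erase (Finset.mem_univ m), Finset.powerset_univ]

/-! ### Evaluation of elements of `ℍ ⊗ ℝ^{2ⁿ}` -/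

/-- The value `∑_K J_K v_K` of `v = ∑_K e_K v_K` at the units `J`. -/
def evalAt {n : ℕ} (J : Fin n → ℍ) (v : Finset (Fin n) → ℍ) : ℍ := ∑ K, ordProd J K * v K

lemma evalAt_add {n : ℕ} (J : Fin n → ℍ) (v w : Finset (Fin n) → ℍ) :
    evalAt J (v + w) = evalAt J v + evalAt J w := by
  simp [evalAt, mul_add, Finset.sum_add_distrib]

lemma evalAt_smul {n : ℕ} (J : Fin n → ℍ) (r : ℝ) (v : Finset (Fin n) → ℍ) :
    evalAt J (r • v) = r • evalAt J v := by
  simp [evalAt, Finset.smul_sum]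

/-- The components of `v` indexed by sets meeting `{0, …, m - 1}` vanish. -/
def SupportedFrom {n : ℕ} (m : ℕ) (v : Finset (Fin n) → ℍ) : Prop :=
  ∀ L, (∃ k ∈ L, k.val < m) → v L = 0

/-- The components of `v` not involving the index `m`. -/
def partOff {n : ℕ} (m : Fin n) (v : Finset (Fin n) → ℍ) : Finset (Fin n) → ℍ :=
  fun L => if m ∈ L then 0 else v L

/-- The components of `v` involving the index `m`, with this index removed. -/
def partOn {n : ℕ} (m : Fin n) (v : Finset (Fin n) → ℍ) : Finset (Fin n) → ℍ :=
  fun L => if m ∈ L then 0 else v (insert m L)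

/-- If `K` has an element below `m`, both values of `v` vanish; otherwise `m` is the least element
of `insert m K`, so `J m` comes first. The second identity serves `complexStr`, which pairs `v K`
with `insert m K`. -/
lemma SupportedFrom.ordProd_insert_mul {n : ℕ} {m : Fin n} {v : Finset (Fin n) → ℍ}
    (hv : SupportedFrom m.val v) (J : Fin n → ℍ) {K : Finset (Fin n)} (hK : m ∉ K) :
    ordProd J (insert m K) * v (insert m K) = J m * (ordProd J K * v (insert m K)) ∧
    ordProd J (insert m K) * v K = J m * (ordProd J K * v K) := by
  by_cases h : ∃ k ∈ K, k.val < m.val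
  · obtain ⟨k, hk, hkm⟩ := h
    rw [hv K ⟨k, hk, hkm⟩, hv (insert m K) ⟨k, Finset.mem_insert_of_mem hk, hkm⟩]
    simp
  · push Not at h
    rw [ordProd_insert_of_lt J fun k hk => lt_of_le_of_ne (h k hk) fun e => hK (e ▸ hk)]
    simp only [mul_assoc, and_self]

lemma evalAt_split {n : ℕ} {m : Fin n} {v : Finset (Fin n) → ℍ} (hv : SupportedFrom m.val v)
    (J : Fin n → ℍ) : evalAt J v = evalAt J (partOff m v) + J m * evalAt J (partOn m v) := by
  simp only [evalAt, Finset.mul_sum, sum_finset_split m]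
  rw [← Finset.sum_add_distrib]
  refine Finset.sum_congr rfl fun K hK => ?_
  have hm : m ∉ K := fun h => by simpa using Finset.mem_powerset.1 hK h
  rw [(hv.ordProd_insert_mul J hm).1]
  simp [partOff, partOn, hm]

/-- With `J m` leftmost, its square `-1` reproduces the sign in the definition of `complexStr`.
Without the support hypothesis the smaller units would intervene. -/
lemma evalAt_complexStr {n : ℕ} {m : Fin n} {v : Finset (Fin n) → ℍ}
    (hv : SupportedFrom m.val v) {J : Fin n → ℍ} (hJ : J m * J m = -1) :
    evalAt J (complexStr m v) = J m * evalAt J v := by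
  simp only [evalAt, Finset.mul_sum, sum_finset_split m]
  refine Finset.sum_congr rfl fun K hK => ?_
  have hm : m ∉ K := fun h => by simpa using Finset.mem_powerset.1 hK h
  rw [(hv.ordProd_insert_mul J hm).1]
  simp only [complexStr, hm, if_false, Finset.mem_insert_self, if_true,
    Finset.erase_insert hm, (hv.ordProd_insert_mul J hm).2, mul_neg]
  simp only [mul_add, ← mul_assoc, hJ]
  simp [add_comm]

/-- The spherical derivative with respect to the `h`-th variable, at the level of stems. -/
def sphVec {n : ℕ} (h : Fin n) (z : Fin n → ℂ) (v : Finset (Fin n) → ℍ) :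
    Finset (Fin n) → ℍ := (z h).im⁻¹ • partOn h v

/-- The multiplication by the `h`-th variable, at the level of stems. -/
def mulVec {n : ℕ} (h : Fin n) (z : Fin n → ℂ) (v : Finset (Fin n) → ℍ) :
    Finset (Fin n) → ℍ := (z h).re • v + (z h).im • complexStr h v

lemma SupportedFrom.mulVec {n : ℕ} {m : ℕ} {h : Fin n} (hm : m ≤ h.val) (z : Fin n → ℂ)
    {v : Finset (Fin n) → ℍ} (hv : SupportedFrom m v) : SupportedFrom m (mulVec h z v) := by
  rintro L ⟨k, hk, hkm⟩
  have hkh : k ≠ h := fun e => by subst e; omega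
  have h1 : v (L.erase h) = 0 := hv _ ⟨k, Finset.mem_erase.2 ⟨hkh, hk⟩, hkm⟩
  have h2 : v (insert h L) = 0 := hv _ ⟨k, Finset.mem_insert_of_mem hk, hkm⟩
  simp [SliceWirtinger.mulVec, complexStr, h1, h2, hv L ⟨k, hk, hkm⟩]

/-- Passing to `partOn` removes the index `h`, so the support moves up by one and the next variable
becomes leftmost. -/
lemma SupportedFrom.sphVec {n : ℕ} {h : Fin n} (z : Fin n → ℂ)
    {v : Finset (Fin n) → ℍ} (hv : SupportedFrom h.val v) :
    SupportedFrom (h.val + 1) (sphVec h z v) := by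
  rintro L ⟨k, hk, hkm⟩
  by_cases hL : h ∈ L
  · simp [SliceWirtinger.sphVec, partOn, hL]
  · have hkh : k ≠ h := fun e => hL (e ▸ hk)
    have hlt : k.val < h.val := by
      have : k.val ≠ h.val := fun e => hkh (Fin.ext e)
      omega
    simp [SliceWirtinger.sphVec, partOn, hL, hv (insert h L) ⟨k, Finset.mem_insert_of_mem hk, hlt⟩]

lemma evalAt_mulVec {n : ℕ} {m : Fin n} {v : Finset (Fin n) → ℍ}
    (hv : SupportedFrom m.val v) {J : Fin n → ℍ} (hJ : J m * J m = -1) (z : Fin n → ℂ) :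
    evalAt J (mulVec m z v) = slicePoint z J m * evalAt J v := by
  rw [mulVec, evalAt_add, evalAt_smul, evalAt_smul, evalAt_complexStr hv hJ, slicePoint, add_mul,
    Quaternion.coe_mul_eq_smul, ← Quaternion.coe_commutes, mul_assoc,
    Quaternion.coe_mul_eq_smul]

/-- Write the value as `a + J b` and `x = α + J β`. The spherical derivative of `x v` is `a + (α /
β) b`, that of `v` is `b / β`, and `-x̄ = -α + J β`; the terms in `α` cancel. -/
lemma evalAt_reconstruct {n : ℕ} {m : Fin n} {v : Finset (Fin n) → ℍ}
    (hv : SupportedFrom m.val v) {J : Fin n → ℍ} (hJ : J m ∈ imSphere) {z : Fin n → ℂ}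
    (hz : (z m).im ≠ 0) :
    evalAt J v = evalAt J (sphVec m z (mulVec m z v)) +
      -star (slicePoint z J m) * evalAt J (sphVec m z v) := by
  have h1 : partOn m (mulVec m z v) = (z m).re • partOn m v + (z m).im • partOff m v := by
    funext L
    by_cases hL : m ∈ L
    · simp [partOn, partOff, hL]
    · simp [partOn, partOff, hL, mulVec, complexStr, Finset.erase_insert hL]
  have h2 : star (J m) = -J m := by
    have := imSphere_re hJ
    ext <;> simp [this]
  have h3 : -star (slicePoint z J m) = -((z m).re : ℍ) + J m * ((z m).im : ℍ) := by
    rw [slicePoint, star_add, star_mul, h2, Quaternion.star_coe, Quaternion.star_coe,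
      Quaternion.coe_commutes]
    simp [add_comm]
  rw [sphVec, sphVec, h1, evalAt_smul, evalAt_add, evalAt_smul, evalAt_smul, evalAt_smul, h3,
    evalAt_split hv]
  generalize evalAt J (partOff m v) = a
  generalize evalAt J (partOn m v) = b
  rw [add_mul, neg_mul, mul_assoc, Quaternion.coe_mul_eq_smul, Quaternion.coe_mul_eq_smul,
    smul_add, smul_smul, smul_smul, smul_smul, smul_smul, inv_mul_cancel₀ hz, mul_inv_cancel₀ hz,
    one_smul, one_smul, mul_comm (z m).re]
  abel

/-- The functions `Γ^m_K`, at the level of stems. -/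
def gammaVec {n : ℕ} (z : Fin n → ℂ) (v : Finset (Fin n) → ℍ) :
    ℕ → Finset (Fin n) → Finset (Fin n) → ℍ
  | 0, _ => v
  | m + 1, K => if h : m < n then
      sphVec ⟨m, h⟩ z (if ⟨m, h⟩ ∈ K then mulVec ⟨m, h⟩ z (gammaVec z v m (K.erase ⟨m, h⟩))
        else gammaVec z v m (K.erase ⟨m, h⟩))
    else 0

lemma gammaVec_supportedFrom {n : ℕ} (z : Fin n → ℂ) (v : Finset (Fin n) → ℍ) (m : ℕ)
    (K : Finset (Fin n)) : SupportedFrom m (gammaVec z v m K) := by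
  induction m generalizing K with
  | zero => rintro L ⟨k, _, hk⟩; omega
  | succ m ih =>
    rw [gammaVec]
    split_ifs with h hK
    · exact SupportedFrom.sphVec (h := ⟨m, h⟩) z ((ih _).mulVec le_rfl z)
    · exact SupportedFrom.sphVec (h := ⟨m, h⟩) z (ih _)
    · intro L _; rfl

/-- Iteration of `evalAt_reconstruct`: each step splits the term of `K` into those of `insert a K`
and `K`. The new factor `-x̄_a` stands to the right of the earlier ones, as required by the
increasing order since `a` is the largest index so far. -/
lemma evalAt_eq_sum_gammaVec {n : ℕ} {z : Fin n → ℂ} (hz : ∀ k, (z k).im ≠ 0)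
    {J : Fin n → ℍ} (hJ : ∀ k, J k ∈ imSphere) (v : Finset (Fin n) → ℍ) {m : ℕ} (hm : m ≤ n) :
    evalAt J v = ∑ K ∈ (Finset.univ.filter fun k : Fin n => k.val < m).powerset,
      ordProd (fun k => -star (slicePoint z J k))
        ((Finset.univ.filter fun k : Fin n => k.val < m) \ K) *
      evalAt J (gammaVec z v m K) := by
  induction m with
  | zero => simp [gammaVec, ordProd_empty]
  | succ m ih =>
    have hmn : m < n := hm
    set a : Fin n := ⟨m, hmn⟩ with ha
    set S := Finset.univ.filter fun k : Fin n => k.val < m with hS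
    have haS : a ∉ S := by simp [hS, ha]
    have hins : (Finset.univ.filter fun k : Fin n => k.val < m + 1) = insert a S := by
      ext k
      simp only [hS, ha, Finset.mem_filter, Finset.mem_univ, true_and, Finset.mem_insert,
        Fin.ext_iff]
      omega
    rw [hins, Finset.sum_powerset_insert haS, ih hmn.le, ← Finset.sum_add_distrib]
    refine Finset.sum_congr rfl fun K hK => ?_
    have hKS := Finset.mem_powerset.1 hK
    have haK : a ∉ K := fun h => haS (hKS h)
    have e1 : insert a S \ K = insert a (S \ K) := Finset.insert_sdiff_of_notMem _ haK
    have e2 : insert a S \ insert a K = S \ K := by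
      ext k
      simp only [Finset.mem_sdiff, Finset.mem_insert]
      constructor
      · tauto
      · rintro ⟨h1, h2⟩
        exact ⟨Or.inr h1, fun h => h.elim (fun e => haS (e ▸ h1)) h2⟩
    have g1 : gammaVec z v (m + 1) K = sphVec a z (gammaVec z v m K) := by
      rw [gammaVec, dif_pos hmn, if_neg haK, Finset.erase_eq_of_notMem haK]
    have g2 : gammaVec z v (m + 1) (insert a K) = sphVec a z (mulVec a z (gammaVec z v m K)) := by
      rw [gammaVec, dif_pos hmn, if_pos (Finset.mem_insert_self _ _), Finset.erase_insert haK]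
    rw [e1, e2, g1, g2, ordProd_insert_of_gt, mul_assoc, ← mul_add,
      evalAt_reconstruct (m := a) (gammaVec_supportedFrom z v m K) (hJ a) (hz a), add_comm]
    intro k hk
    have := (Finset.mem_sdiff.1 hk).1
    simpa [hS, ha, Fin.lt_def] using this

/-! ### The product of `ℍ ⊗ ℝ^{2ⁿ}` -/

lemma tensorMul_add_left {n : ℕ} (u u' v : Finset (Fin n) → ℍ) :
    tensorMul (u + u') v = tensorMul u v + tensorMul u' v := by
  funext L
  simp only [tensorMul, Pi.add_apply, ← Finset.sum_add_distrib]
  refine Finset.sum_congr rfl fun H _ => Finset.sum_congr rfl fun K _ => ?_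
  split_ifs <;> simp [add_mul, mul_add]

lemma tensorMul_add_right {n : ℕ} (u v v' : Finset (Fin n) → ℍ) :
    tensorMul u (v + v') = tensorMul u v + tensorMul u v' := by
  funext L
  simp only [tensorMul, Pi.add_apply, ← Finset.sum_add_distrib]
  refine Finset.sum_congr rfl fun H _ => Finset.sum_congr rfl fun K _ => ?_
  split_ifs <;> simp [mul_add]

lemma tensorMul_smul_left {n : ℕ} (r : ℝ) (u v : Finset (Fin n) → ℍ) :
    tensorMul (r • u) v = r • tensorMul u v := by
  funext L
  simp only [tensorMul, Pi.smul_apply, Finset.smul_sum]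
  refine Finset.sum_congr rfl fun H _ => Finset.sum_congr rfl fun K _ => ?_
  split_ifs <;> simp

lemma tensorMul_smul_right {n : ℕ} (r : ℝ) (u v : Finset (Fin n) → ℍ) :
    tensorMul u (r • v) = r • tensorMul u v := by
  funext L
  simp only [tensorMul, Pi.smul_apply, Finset.smul_sum]
  refine Finset.sum_congr rfl fun H _ => Finset.sum_congr rfl fun K _ => ?_
  split_ifs <;> simp

/-- Adding or removing the index `h`. -/
def toggle {n : ℕ} (h : Fin n) (K : Finset (Fin n)) : Finset (Fin n) :=
  if h ∈ K then K.erase h else insert h K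

lemma mem_toggle {n : ℕ} {h k : Fin n} {K : Finset (Fin n)} :
    k ∈ toggle h K ↔ if k = h then k ∉ K else k ∈ K := by
  unfold toggle
  split_ifs with h1 h2 h2 <;> simp_all

lemma toggle_toggle {n : ℕ} (h : Fin n) (K : Finset (Fin n)) : toggle h (toggle h K) = K := by
  ext k
  simp only [mem_toggle]
  split_ifs <;> simp

/-- The permutation of the subsets given by `toggle`. -/
def toggleEquiv {n : ℕ} (h : Fin n) : Finset (Fin n) ≃ Finset (Fin n) where
  toFun := toggle h
  invFun := toggle h
  left_inv := toggle_toggle h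
  right_inv := toggle_toggle h

lemma symmDiff_toggle_eq_iff {n : ℕ} (h : Fin n) (H K L : Finset (Fin n)) :
    symmDiff (toggle h H) K = L ↔ symmDiff H K = toggle h L := by
  simp only [Finset.ext_iff, Finset.mem_symmDiff, mem_toggle]
  refine forall_congr' fun k => ?_
  split_ifs <;> tauto

lemma complexStr_eq_toggle {n : ℕ} (h : Fin n) (v : Finset (Fin n) → ℍ) (K : Finset (Fin n)) :
    complexStr h v K = (if h ∈ K then (1 : ℝ) else -1) • v (toggle h K) := by
  unfold complexStr toggle
  split_ifs <;> simp

/-- The sign bookkeeping behind linearity of the product over `complexStr h`: toggling `h` in `H`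
changes the cardinality of `H ∩ K` exactly when `h ∈ K`, and this compensates the change of sign of
the complex structure. -/
lemma neg_one_pow_card_toggle_inter {n : ℕ} (h : Fin n) {H K L : Finset (Fin n)}
    (e : symmDiff H K = toggle h L) :
    (-1 : ℝ) ^ (toggle h H ∩ K).card * (if h ∈ toggle h H then (1 : ℝ) else -1) =
      (if h ∈ L then (1 : ℝ) else -1) * (-1) ^ (H ∩ K).card := by
  have hmem : (h ∈ symmDiff H K) ↔ h ∉ L := by rw [e, mem_toggle]; simp
  rw [Finset.mem_symmDiff] at hmem
  by_cases hK : h ∈ K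
  · by_cases hH : h ∈ H
    · have hL : h ∈ L := by tauto
      have e1 : toggle h H ∩ K = (H ∩ K).erase h := by
        ext k; simp only [Finset.mem_inter, mem_toggle, Finset.mem_erase]; split_ifs <;> simp_all
      have e2 := Finset.card_erase_add_one (Finset.mem_inter.2 ⟨hH, hK⟩)
      rw [e1, ← e2, pow_succ]
      simp [mem_toggle, hH, hL]
    · have hL : h ∉ L := by tauto
      have e1 : toggle h H ∩ K = insert h (H ∩ K) := by
        ext k; simp only [Finset.mem_inter, mem_toggle, Finset.mem_insert]; split_ifs <;> simp_all
      rw [e1, Finset.card_insert_of_notMem (by simp [hH]), pow_succ]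
      simp [mem_toggle, hH, hL]
  · have e1 : toggle h H ∩ K = H ∩ K := by
      ext k; simp only [Finset.mem_inter, mem_toggle]; split_ifs <;> simp_all
    have hL : (h ∈ L) ↔ h ∉ H := by tauto
    rw [e1, mul_comm]
    simp [mem_toggle, hL]

lemma tensorMul_apply_eq {n : ℕ} (u v : Finset (Fin n) → ℍ) (L : Finset (Fin n)) :
    tensorMul u v L = ∑ H, ∑ K, if symmDiff H K = L then
      ((-1 : ℝ) ^ (H ∩ K).card) • (u H * v K) else 0 := by
  refine Finset.sum_congr rfl fun H _ => Finset.sum_congr rfl fun K _ => ?_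
  have : ((-1 : ℍ) ^ (H ∩ K).card) = (((-1 : ℝ) ^ (H ∩ K).card : ℝ) : ℍ) := by simp
  rw [this, Quaternion.coe_mul_eq_smul]

lemma tensorMul_complexStr_left {n : ℕ} (h : Fin n) (u v : Finset (Fin n) → ℍ) :
    tensorMul (complexStr h u) v = complexStr h (tensorMul u v) := by
  funext L
  rw [complexStr_eq_toggle, tensorMul_apply_eq, tensorMul_apply_eq,
    -- Reindexing by `toggle` moves the complex structure from the factor to the index of the
    -- product.
    ← Equiv.sum_comp (toggleEquiv h)]
  simp only [Finset.smul_sum]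
  refine Finset.sum_congr rfl fun H _ => Finset.sum_congr rfl fun K _ => ?_
  change (if symmDiff (toggle h H) K = L then _ else _) = _
  simp only [symmDiff_toggle_eq_iff, smul_ite, smul_zero]
  split_ifs with e1 e2
  all_goals try rfl
  all_goals
    change (-1 : ℝ) ^ (toggle h H ∩ K).card • (complexStr h u (toggle h H) * v K) = _
    rw [complexStr_eq_toggle, toggle_toggle, smul_mul_assoc, smul_smul, smul_smul,
      neg_one_pow_card_toggle_inter h e1]
    simp [*]

lemma tensorMul_complexStr_right {n : ℕ} (h : Fin n) (u v : Finset (Fin n) → ℍ) :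
    tensorMul u (complexStr h v) = complexStr h (tensorMul u v) := by
  funext L
  rw [complexStr_eq_toggle, tensorMul_apply_eq, tensorMul_apply_eq]
  simp only [Finset.smul_sum]
  refine Finset.sum_congr rfl fun H _ => ?_
  rw [← Equiv.sum_comp (toggleEquiv h)]
  refine Finset.sum_congr rfl fun K _ => ?_
  change (if symmDiff H (toggle h K) = L then _ else _) = _
  simp only [symmDiff_comm H, symmDiff_toggle_eq_iff, smul_ite, smul_zero]
  split_ifs with e1 e2
  all_goals try rfl
  all_goals
    change (-1 : ℝ) ^ (H ∩ toggle h K).card • (u H * complexStr h v (toggle h K)) = _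
    rw [complexStr_eq_toggle, toggle_toggle, mul_smul_comm, smul_smul, smul_smul,
      Finset.inter_comm, neg_one_pow_card_toggle_inter h e1, Finset.inter_comm]
    simp [*]

lemma complexStr_comm {n : ℕ} (l m : Fin n) (v : Finset (Fin n) → ℍ) :
    complexStr l (complexStr m v) = complexStr m (complexStr l v) := by
  by_cases hlm : l = m
  · rw [hlm]
  funext K
  have ht : toggle m (toggle l K) = toggle l (toggle m K) := by
    ext k
    simp only [mem_toggle]
    split_ifs <;> simp_all
  simp only [complexStr_eq_toggle, mem_toggle, hlm, Ne.symm hlm, if_false, ht, smul_smul]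
  rw [mul_comm]

lemma complexStr_partOn_comm {n : ℕ} {h m : Fin n} (hm : m ≠ h) (v : Finset (Fin n) → ℍ) :
    complexStr m (partOn h v) = partOn h (complexStr m v) := by
  funext K
  by_cases hK : h ∈ K
  · simp [complexStr, partOn, hK, hm.symm]
  · simp only [complexStr, partOn, hK, hm, hm.symm, Finset.mem_insert, Finset.mem_erase, if_false,
      false_or, and_false, Finset.insert_comm m h]
    split_ifs
    · rw [Finset.erase_insert_of_ne hm.symm]
    · rfl

lemma complexStr_add {n : ℕ} (m : Fin n) (v w : Finset (Fin n) → ℍ) :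
    complexStr m (v + w) = complexStr m v + complexStr m w := by
  funext K
  simp only [complexStr, Pi.add_apply]
  split_ifs
  · rfl
  · abel

lemma complexStr_smul {n : ℕ} (m : Fin n) (r : ℝ) (v : Finset (Fin n) → ℍ) :
    complexStr m (r • v) = r • complexStr m v := by
  funext K
  simp only [complexStr, Pi.smul_apply]
  split_ifs <;> simp

/-! ### The polar coordinates of a quaternion -/

lemma sliceUnit_mem (q : ℍ) : sliceUnit q ∈ imSphere := by
  change sliceUnit q * sliceUnit q = -1
  unfold sliceUnit
  split_ifs with h
  · have e : imUnit 0 = (⟨0, 1, 0, 0⟩ : ℍ) := rfl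
    rw [e]
    refine (QuaternionAlgebra.mk_mul_mk ..).trans ?_
    apply QuaternionAlgebra.ext <;> simp
  · have hn : ‖q.im‖ ≠ 0 := norm_ne_zero_iff.2 h
    have h2 : q.im * q.im = -((‖q.im‖ * ‖q.im‖ : ℝ) : ℍ) := by
      rw [← Quaternion.normSq_eq_norm_mul_self, ← Quaternion.self_mul_star, Quaternion.star_im]
      simp
    rw [smul_mul_smul_comm, h2, ← Quaternion.coe_neg, Quaternion.smul_coe,
      show ‖q.im‖⁻¹ * ‖q.im‖⁻¹ * -(‖q.im‖ * ‖q.im‖) = -1 by field_simp]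
    simp

lemma norm_im_smul_sliceUnit (q : ℍ) : ‖q.im‖ • sliceUnit q = q.im := by
  unfold sliceUnit
  split_ifs with h
  · simp [h]
  · rw [smul_smul, mul_inv_cancel₀ (norm_ne_zero_iff.2 h), one_smul]

lemma slicePoint_sliceUnit {n : ℕ} (x : Fin n → ℍ) :
    slicePoint (fun h => complexCoord (x h)) (fun h => sliceUnit (x h)) = x := by
  funext h
  change ((x h).re : ℍ) + sliceUnit (x h) * ((‖(x h).im‖ : ℝ) : ℍ) = x h
  rw [← Quaternion.coe_commutes, Quaternion.coe_mul_eq_smul, norm_im_smul_sliceUnit,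
    Quaternion.re_add_im]

/-- The imaginary part as a continuous linear map. -/
def imCLM : ℍ →L[ℝ] ℍ where
  toFun q := q.im
  map_add' a b := by simp
  map_smul' r a := by simp
  cont := Quaternion.continuous_im

/-- The real part as a continuous linear map. -/
def reCLM : ℍ →L[ℝ] ℝ where
  toFun q := q.re
  map_add' a b := by simp
  map_smul' r a := by simp
  cont := Quaternion.continuous_re

/-- The derivative at `q` of the norm of the imaginary part. -/
def normImDeriv (q : ℍ) : ℍ →L[ℝ] ℝ := ‖q.im‖⁻¹ • (innerSL ℝ q.im).comp imCLM

lemma hasFDerivAt_norm_im {q : ℍ} (hq : q.im ≠ 0) :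
    HasFDerivAt (fun p : ℍ => ‖p.im‖) (normImDeriv q) q := by
  have h1 : HasFDerivAt (fun p : ℍ => p.im) imCLM q := imCLM.hasFDerivAt
  have hn : ‖q.im‖ ≠ 0 := norm_ne_zero_iff.2 hq
  -- The norm is differentiated as the square root of its square, which is nonzero at `q`.
  have h2 := h1.norm_sq.sqrt (pow_ne_zero 2 hn)
  have e : (fun p : ℍ => √(‖p.im‖ ^ 2)) = fun p : ℍ => ‖p.im‖ := by
    funext p; exact Real.sqrt_sq (norm_nonneg _)
  rw [e, Real.sqrt_sq (norm_nonneg _)] at h2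
  refine h2.congr_fderiv ?_
  ext u
  simp only [normImDeriv, smul_apply, nsmul_eq_mul, smul_eq_mul]
  field_simp
  simp

/-- The derivative of `complexCoord` at `q`. -/
def complexCoordDeriv (q : ℍ) : ℍ →L[ℝ] ℂ :=
  (reCLM.smulRight (1 : ℂ)) + (normImDeriv q).smulRight Complex.I

lemma complexCoord_eq (q : ℍ) : complexCoord q = q.re • (1 : ℂ) + ‖q.im‖ • Complex.I := by
  apply Complex.ext <;> simp [complexCoord]

lemma hasFDerivAt_complexCoord {q : ℍ} (hq : q.im ≠ 0) :
    HasFDerivAt complexCoord (complexCoordDeriv q) q := by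
  have h1 : HasFDerivAt (fun p : ℍ => p.re) reCLM q := reCLM.hasFDerivAt
  have e : complexCoord = fun p : ℍ => p.re • (1 : ℂ) + ‖p.im‖ • Complex.I :=
    funext complexCoord_eq
  rw [e]
  exact (h1.smul_const 1).add ((hasFDerivAt_norm_im hq).smul_const Complex.I)

/-- The derivative of `sliceUnit` at `q`. -/
def sliceUnitDeriv (q : ℍ) : ℍ →L[ℝ] ℍ :=
  ‖q.im‖⁻¹ • imCLM + ((-(‖q.im‖ ^ 2)⁻¹) • normImDeriv q).smulRight q.im

lemma hasFDerivAt_sliceUnit {q : ℍ} (hq : q.im ≠ 0) :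
    HasFDerivAt sliceUnit (sliceUnitDeriv q) q := by
  have h1 : HasFDerivAt (fun p : ℍ => p.im) imCLM q := imCLM.hasFDerivAt
  have hn : ‖q.im‖ ≠ 0 := norm_ne_zero_iff.2 hq
  have h2 := ((hasDerivAt_inv hn).comp_hasFDerivAt q (hasFDerivAt_norm_im hq)).smul h1
  refine h2.congr_of_eventuallyEq ?_
  have : ∀ᶠ p : ℍ in nhds q, p.im ≠ 0 := Quaternion.continuous_im.continuousAt.eventually_ne hq
  filter_upwards [this] with p hp
  simp [sliceUnit, hp]

lemma normImDeriv_one (q : ℍ) : normImDeriv q 1 = 0 := by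
  simp [normImDeriv, imCLM]

lemma normImDeriv_im {q : ℍ} (hq : q.im ≠ 0) : normImDeriv q q.im = ‖q.im‖ := by
  have hn : ‖q.im‖ ≠ 0 := norm_ne_zero_iff.2 hq
  simp only [normImDeriv, imCLM, smul_apply, ContinuousLinearMap.comp_apply,
    ContinuousLinearMap.coe_mk', LinearMap.coe_mk, AddHom.coe_mk, innerSL_apply_apply,
    Quaternion.im_idem, real_inner_self_eq_norm_sq, smul_eq_mul]
  field_simp

lemma imUnit_re (i : Fin 3) : (imUnit i).re = 0 := by fin_cases i <;> rfl

lemma imUnit_imI (i : Fin 3) : (imUnit i).imI = if i = 0 then 1 else 0 := by fin_cases i <;> rfl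

lemma imUnit_imJ (i : Fin 3) : (imUnit i).imJ = if i = 1 then 1 else 0 := by fin_cases i <;> rfl

lemma imUnit_imK (i : Fin 3) : (imUnit i).imK = if i = 2 then 1 else 0 := by fin_cases i <;> rfl

lemma imUnit_im (i : Fin 3) : (imUnit i).im = imUnit i := by fin_cases i <;> rfl

lemma normImDeriv_imUnit (q : ℍ) (i : Fin 3) :
    normImDeriv q (imUnit i) = ‖q.im‖⁻¹ * imCoord i q := by
  have : inner ℝ q.im (imUnit i).im = imCoord i q := by
    rw [Quaternion.inner_def, imUnit_im]
    fin_cases i <;> simp [imUnit_re, imUnit_imI, imUnit_imJ, imUnit_imK, imCoord]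
  simp only [normImDeriv, imCLM, smul_apply, ContinuousLinearMap.comp_apply,
    ContinuousLinearMap.coe_mk', LinearMap.coe_mk, AddHom.coe_mk, innerSL_apply_apply, this,
    smul_eq_mul]

lemma complexCoordDeriv_apply (q u : ℍ) :
    complexCoordDeriv q u = u.re • (1 : ℂ) + normImDeriv q u • Complex.I := rfl

lemma sliceUnitDeriv_apply (q u : ℍ) :
    sliceUnitDeriv q u = ‖q.im‖⁻¹ • u.im + (-(‖q.im‖ ^ 2)⁻¹ * normImDeriv q u) • q.im := rfl

lemma complexCoordDeriv_one (q : ℍ) : complexCoordDeriv q 1 = 1 := by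
  simp [complexCoordDeriv_apply, normImDeriv_one]

lemma complexCoordDeriv_im {q : ℍ} (hq : q.im ≠ 0) :
    complexCoordDeriv q q.im = ‖q.im‖ • Complex.I := by
  simp [complexCoordDeriv_apply, normImDeriv_im hq]

lemma complexCoordDeriv_imUnit (q : ℍ) (i : Fin 3) :
    complexCoordDeriv q (imUnit i) = (‖q.im‖⁻¹ * imCoord i q) • Complex.I := by
  simp [complexCoordDeriv_apply, normImDeriv_imUnit, imUnit_re]

lemma sliceUnitDeriv_one (q : ℍ) : sliceUnitDeriv q 1 = 0 := by
  simp [sliceUnitDeriv_apply, normImDeriv_one]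

lemma sliceUnitDeriv_im {q : ℍ} (hq : q.im ≠ 0) : sliceUnitDeriv q q.im = 0 := by
  have hn : ‖q.im‖ ≠ 0 := norm_ne_zero_iff.2 hq
  rw [sliceUnitDeriv_apply, normImDeriv_im hq, Quaternion.im_idem, ← add_smul,
    show ‖q.im‖⁻¹ + -(‖q.im‖ ^ 2)⁻¹ * ‖q.im‖ = 0 by field_simp; ring, zero_smul]

/-- The second summand is radial and proportional to `imCoord i q`, so it drops out of the
antisymmetrised operators `L_{ij}`. -/
lemma sliceUnitDeriv_imUnit (q : ℍ) (i : Fin 3) :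
    sliceUnitDeriv q (imUnit i) = ‖q.im‖⁻¹ • imUnit i +
      (-(‖q.im‖ ^ 2)⁻¹ * (‖q.im‖⁻¹ * imCoord i q)) • q.im := by
  rw [sliceUnitDeriv_apply, normImDeriv_imUnit, imUnit_im]

lemma sum_imCoord_smul_imUnit (q : ℍ) : ∑ i, imCoord i q • imUnit i = q.im := by
  rw [Fin.sum_univ_three]
  ext <;> simp [imCoord, imUnit_re, imUnit_imI, imUnit_imJ, imUnit_imK]

/-- The factor `-4`, times the `-1/2` in `Γ`, yields the eigenvalue `2` of `Γ` on `Im x`; the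
normalisation `(2 Im x)⁻¹` compensates for it. -/
lemma imUnit_dirac_sum (q b : ℍ) :
    ∑ i, ∑ j, imUnit i * imUnit j * ((imCoord i q • imUnit j - imCoord j q • imUnit i) * b) =
      (-4 : ℝ) • (q.im * b) := by
  have h : ∑ i, ∑ j, imUnit i * imUnit j * (imCoord i q • imUnit j - imCoord j q • imUnit i) =
      (-4 : ℝ) • q.im := by
    simp only [Fin.sum_univ_three]
    ext <;> simp [imCoord, imUnit_re, imUnit_imI, imUnit_imJ, imUnit_imK] <;> ring
  simp only [← mul_assoc, ← Finset.sum_mul]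
  rw [h, smul_mul_assoc]

/-! ### Directional derivatives of stems -/

/-- A directional derivative sees only the restriction to a line, so factors constant along that
line can be frozen even though they are not locally constant. -/
lemma fderiv_apply_eq_of_line {E F : Type*} [NormedAddCommGroup E] [NormedSpace ℝ E]
    [NormedAddCommGroup F] [NormedSpace ℝ F] {f g : E → F} {x v : E}
    (hf : DifferentiableAt ℝ f x) (hg : DifferentiableAt ℝ g x)
    (h : ∀ t : ℝ, f (x + t • v) = g (x + t • v)) : fderiv ℝ f x v = fderiv ℝ g x v := by
  rw [← hf.lineDeriv_eq_fderiv, ← hg.lineDeriv_eq_fderiv, lineDeriv, lineDeriv]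
  simp only [h]

/-- All the components of the family `G` are differentiable at `z`. -/
def StemDiffAt {n : ℕ} (G : (Fin n → ℂ) → Finset (Fin n) → ℍ) (z : Fin n → ℂ) : Prop :=
  ∀ L, DifferentiableAt ℝ (fun w => G w L) z

/-- The componentwise derivative of `G` at `z` in the direction `v`. -/
def stemDeriv {n : ℕ} (v : Fin n → ℂ) (G : (Fin n → ℂ) → Finset (Fin n) → ℍ) (z : Fin n → ℂ) :
    Finset (Fin n) → ℍ := fun L => fderiv ℝ (fun w => G w L) z v

/-- The Cauchy-Riemann operator `½ (∂/∂α_m - ε 𝓙_m ∂/∂β_m)`. -/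
def stemCR {n : ℕ} (ε : ℝ) (m : Fin n) (G : (Fin n → ℂ) → Finset (Fin n) → ℍ) (z : Fin n → ℂ) :
    Finset (Fin n) → ℍ :=
  (1 / 2 : ℝ) • (stemDeriv (Pi.single m 1) G z +
    (-ε) • complexStr m (stemDeriv (Pi.single m Complex.I) G z))

lemma stemDel_eq {n : ℕ} (m : Fin n) (G : (Fin n → ℂ) → Finset (Fin n) → ℍ) :
    stemDel m G = stemCR 1 m G := by
  funext z K
  simp [stemDel, stemCR, stemDeriv, sub_eq_add_neg]
  rfl

lemma stemDelBar_eq {n : ℕ} (m : Fin n) (G : (Fin n → ℂ) → Finset (Fin n) → ℍ) :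
    stemDelBar m G = stemCR (-1) m G := by
  funext z K
  simp [stemDelBar, stemCR, stemDeriv]
  rfl

lemma partOn_add {n : ℕ} (m : Fin n) (v w : Finset (Fin n) → ℍ) :
    partOn m (v + w) = partOn m v + partOn m w := by
  funext K
  simp only [partOn, Pi.add_apply]
  split_ifs <;> simp

lemma partOn_smul {n : ℕ} (m : Fin n) (r : ℝ) (v : Finset (Fin n) → ℍ) :
    partOn m (r • v) = r • partOn m v := by
  funext K
  simp only [partOn, Pi.smul_apply]
  split_ifs <;> simp

lemma partOff_stemDeriv {n : ℕ} (h : Fin n) (v : Fin n → ℂ)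
    (G : (Fin n → ℂ) → Finset (Fin n) → ℍ) (z : Fin n → ℂ) :
    stemDeriv v (fun w => partOff h (G w)) z = partOff h (stemDeriv v G z) := by
  funext L
  by_cases hL : h ∈ L <;> simp [stemDeriv, partOff, hL]

lemma partOn_stemDeriv {n : ℕ} (h : Fin n) (v : Fin n → ℂ)
    (G : (Fin n → ℂ) → Finset (Fin n) → ℍ) (z : Fin n → ℂ) :
    stemDeriv v (fun w => partOn h (G w)) z = partOn h (stemDeriv v G z) := by
  funext L
  by_cases hL : h ∈ L <;> simp [stemDeriv, partOn, hL]

lemma complexStr_stemDeriv {n : ℕ} (h : Fin n) (v : Fin n → ℂ)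
    (G : (Fin n → ℂ) → Finset (Fin n) → ℍ) (z : Fin n → ℂ) :
    stemDeriv v (fun w => complexStr h (G w)) z = complexStr h (stemDeriv v G z) := by
  funext L
  by_cases hL : h ∈ L
  · simp [stemDeriv, complexStr, hL]
  · simp only [stemDeriv, complexStr, hL, if_false]
    rw [fderiv_fun_neg]
    rfl

lemma StemDiffAt.partOff {n : ℕ} {G : (Fin n → ℂ) → Finset (Fin n) → ℍ} {z : Fin n → ℂ}
    (hG : StemDiffAt G z) (h : Fin n) : StemDiffAt (fun w => partOff h (G w)) z := by
  intro L
  by_cases hL : h ∈ L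
  · simp [SliceWirtinger.partOff, hL]
  · simpa [SliceWirtinger.partOff, hL] using hG L

lemma StemDiffAt.partOn {n : ℕ} {G : (Fin n → ℂ) → Finset (Fin n) → ℍ} {z : Fin n → ℂ}
    (hG : StemDiffAt G z) (h : Fin n) : StemDiffAt (fun w => partOn h (G w)) z := by
  intro L
  by_cases hL : h ∈ L
  · simp [SliceWirtinger.partOn, hL]
  · simpa [SliceWirtinger.partOn, hL] using hG (insert h L)

lemma StemDiffAt.complexStr {n : ℕ} {G : (Fin n → ℂ) → Finset (Fin n) → ℍ} {z : Fin n → ℂ}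
    (hG : StemDiffAt G z) (h : Fin n) : StemDiffAt (fun w => complexStr h (G w)) z := by
  intro L
  by_cases hL : h ∈ L
  · simpa [SliceWirtinger.complexStr, hL] using hG (L.erase h)
  · simpa [SliceWirtinger.complexStr, hL] using (hG (insert h L)).neg

lemma differentiableAt_re_apply {n : ℕ} (h : Fin n) (z : Fin n → ℂ) :
    DifferentiableAt ℝ (fun w : Fin n → ℂ => (w h).re) z :=
  (Complex.reCLM.comp
    (ContinuousLinearMap.proj (R := ℝ) (φ := fun _ : Fin n => ℂ) h)).differentiableAt

lemma differentiableAt_im_apply {n : ℕ} (h : Fin n) (z : Fin n → ℂ) :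
    DifferentiableAt ℝ (fun w : Fin n → ℂ => (w h).im) z :=
  (Complex.imCLM.comp
    (ContinuousLinearMap.proj (R := ℝ) (φ := fun _ : Fin n => ℂ) h)).differentiableAt

lemma StemDiffAt.smul {n : ℕ} {G : (Fin n → ℂ) → Finset (Fin n) → ℍ} {z : Fin n → ℂ}
    (hG : StemDiffAt G z) {c : (Fin n → ℂ) → ℝ} (hc : DifferentiableAt ℝ c z) :
    StemDiffAt (fun w => c w • G w) z := fun L => hc.smul (hG L)

lemma StemDiffAt.add {n : ℕ} {F G : (Fin n → ℂ) → Finset (Fin n) → ℍ} {z : Fin n → ℂ}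
    (hF : StemDiffAt F z) (hG : StemDiffAt G z) : StemDiffAt (fun w => F w + G w) z :=
  fun L => (hF L).add (hG L)

lemma StemDiffAt.sphVec {n : ℕ} {G : (Fin n → ℂ) → Finset (Fin n) → ℍ} {z : Fin n → ℂ}
    (hG : StemDiffAt G z) {h : Fin n} (hz : (z h).im ≠ 0) :
    StemDiffAt (fun w => sphVec h w (G w)) z :=
  (hG.partOn h).smul ((differentiableAt_im_apply h z).inv hz)

lemma StemDiffAt.mulVec {n : ℕ} {G : (Fin n → ℂ) → Finset (Fin n) → ℍ} {z : Fin n → ℂ}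
    (hG : StemDiffAt G z) (h : Fin n) : StemDiffAt (fun w => mulVec h w (G w)) z :=
  (hG.smul (differentiableAt_re_apply h z)).add
    ((hG.complexStr h).smul (differentiableAt_im_apply h z))

lemma stemDeriv_add {n : ℕ} {F G : (Fin n → ℂ) → Finset (Fin n) → ℍ} {z : Fin n → ℂ}
    (hF : StemDiffAt F z) (hG : StemDiffAt G z) (v : Fin n → ℂ) :
    stemDeriv v (fun w => F w + G w) z = stemDeriv v F z + stemDeriv v G z := by
  funext L
  simp only [stemDeriv, Pi.add_apply]
  rw [fderiv_fun_add (hF L) (hG L)]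
  rfl

lemma stemDeriv_smul {n : ℕ} {G : (Fin n → ℂ) → Finset (Fin n) → ℍ} {z v : Fin n → ℂ}
    (hG : StemDiffAt G z) {c : (Fin n → ℂ) → ℝ} (hc : DifferentiableAt ℝ c z)
    (h : ∀ t : ℝ, c (z + t • v) = c z) :
    stemDeriv v (fun w => c w • G w) z = c z • stemDeriv v G z := by
  funext L
  simp only [stemDeriv, Pi.smul_apply]
  rw [fderiv_apply_eq_of_line (f := fun w => c w • G w L) (g := fun w => c z • G w L)
    (hc.smul (hG L)) ((hG L).const_smul (c z)),
    fderiv_fun_const_smul (hG L)]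
  · rfl
  · intro t; rw [h]

lemma stemDeriv_sphVec {n : ℕ} {G : (Fin n → ℂ) → Finset (Fin n) → ℍ} {z : Fin n → ℂ}
    (hG : StemDiffAt G z) {h m : Fin n} (hm : m ≠ h) (hz : (z h).im ≠ 0) (v : ℂ) :
    stemDeriv (Pi.single m v) (fun w => sphVec h w (G w)) z =
      sphVec h z (stemDeriv (Pi.single m v) G z) := by
  simp only [sphVec]
  rw [stemDeriv_smul (c := fun w => (w h).im⁻¹) (hG.partOn h)
    ((differentiableAt_im_apply h z).inv hz), partOn_stemDeriv]
  intro t; simp [hm.symm]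

lemma stemDeriv_mulVec {n : ℕ} {G : (Fin n → ℂ) → Finset (Fin n) → ℍ} {z : Fin n → ℂ}
    (hG : StemDiffAt G z) {h m : Fin n} (hm : m ≠ h) (v : ℂ) :
    stemDeriv (Pi.single m v) (fun w => mulVec h w (G w)) z =
      mulVec h z (stemDeriv (Pi.single m v) G z) := by
  simp only [mulVec]
  rw [stemDeriv_add (hG.smul (differentiableAt_re_apply h z))
    ((hG.complexStr h).smul (differentiableAt_im_apply h z)),
    stemDeriv_smul hG (differentiableAt_re_apply h z),
    stemDeriv_smul (hG.complexStr h) (differentiableAt_im_apply h z), complexStr_stemDeriv]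
  all_goals intro t; simp [hm.symm]

/-- The coefficient depends on `z_h` only, hence is constant in the directions of `z_m`, and
removing the index `h` does not interfere with `complexStr m`. -/
lemma stemCR_sphVec {n : ℕ} {G : (Fin n → ℂ) → Finset (Fin n) → ℍ} {z : Fin n → ℂ}
    (hG : StemDiffAt G z) {h m : Fin n} (hm : m ≠ h) (hz : (z h).im ≠ 0) (ε : ℝ) :
    stemCR ε m (fun w => sphVec h w (G w)) z = sphVec h z (stemCR ε m G z) := by
  simp only [stemCR, stemDeriv_sphVec hG hm hz]
  simp only [sphVec, partOn_add, partOn_smul, complexStr_smul, complexStr_partOn_comm hm]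
  module

lemma stemCR_mulVec {n : ℕ} {G : (Fin n → ℂ) → Finset (Fin n) → ℍ} {z : Fin n → ℂ}
    (hG : StemDiffAt G z) {h m : Fin n} (hm : m ≠ h) (ε : ℝ) :
    stemCR ε m (fun w => mulVec h w (G w)) z = mulVec h z (stemCR ε m G z) := by
  simp only [stemCR, stemDeriv_mulVec hG hm]
  simp only [mulVec, complexStr_add, complexStr_smul, complexStr_comm m h]
  module

lemma StemDiffAt.gammaVec {n : ℕ} {G : (Fin n → ℂ) → Finset (Fin n) → ℍ} {z : Fin n → ℂ}
    (hG : StemDiffAt G z) (hz : ∀ k, (z k).im ≠ 0) (m : ℕ) (K : Finset (Fin n)) :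
    StemDiffAt (fun w => gammaVec w (G w) m K) z := by
  induction m generalizing K with
  | zero => exact hG
  | succ m ih =>
    simp only [SliceWirtinger.gammaVec]
    split_ifs with h hK
    · exact ((ih _).mulVec _).sphVec (hz _)
    · exact (ih _).sphVec (hz _)
    · intro L; exact differentiableAt_const _

/-- For `j ≤ m` the construction uses only the variables of index below `m`, each of which commutes
with the operator in `z_m`. -/
lemma stemCR_gammaVec {n : ℕ} {G : (Fin n → ℂ) → Finset (Fin n) → ℍ} {z : Fin n → ℂ}
    (hG : StemDiffAt G z) (hz : ∀ k, (z k).im ≠ 0) {m : Fin n} (ε : ℝ) {j : ℕ} (hj : j ≤ m.val)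
    (K : Finset (Fin n)) :
    stemCR ε m (fun w => gammaVec w (G w) j K) z = gammaVec z (stemCR ε m G z) j K := by
  induction j generalizing K with
  | zero => rfl
  | succ j ih =>
    have hjn : j < n := by omega
    have hm : m ≠ ⟨j, hjn⟩ := fun e => by rw [e] at hj; simp at hj
    simp only [gammaVec, dif_pos hjn]
    split_ifs with hK
    · rw [stemCR_sphVec ((hG.gammaVec hz j _).mulVec _) hm (hz _),
        stemCR_mulVec (hG.gammaVec hz j _) hm, ih (by omega)]
    · rw [stemCR_sphVec (hG.gammaVec hz j _) hm (hz _), ih (by omega)]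

/-! ### Derivatives of slice functions -/

lemma DifferentiableAt.ordProd {n : ℕ} {E : Type*} [NormedAddCommGroup E] [NormedSpace ℝ E]
    {J : E → Fin n → ℍ} {x : E} (h : ∀ k, DifferentiableAt ℝ (fun y => J y k) x)
    (K : Finset (Fin n)) : DifferentiableAt ℝ (fun y => ordProd (J y) K) x := by
  unfold SliceWirtinger.ordProd
  induction K.sort (fun a b => a ≤ b) with
  | nil => exact differentiableAt_const _
  | cons a l ih =>
    simp only [List.map_cons, List.prod_cons]
    exact DifferentiableAt.fun_mul (h a) ih

lemma hasFDerivAt_complexCoord_pi {n : ℕ} {x : Fin n → ℍ} (hx : ∀ k, (x k).im ≠ 0) :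
    HasFDerivAt (fun (y : Fin n → ℍ) h => complexCoord (y h))
      (ContinuousLinearMap.pi fun h =>
        (complexCoordDeriv (x h)).comp (ContinuousLinearMap.proj h)) x := by
  rw [hasFDerivAt_pi]
  intro h
  exact (hasFDerivAt_complexCoord (hx h)).comp x
    (ContinuousLinearMap.proj (R := ℝ) (φ := fun _ : Fin n => ℍ) h).hasFDerivAt

lemma differentiableAt_sliceUnit_apply {n : ℕ} {x : Fin n → ℍ} {k : Fin n} (hx : (x k).im ≠ 0) :
    DifferentiableAt ℝ (fun y : Fin n → ℍ => sliceUnit (y k)) x :=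
  (HasFDerivAt.comp (f := fun y : Fin n → ℍ => y k) x (hasFDerivAt_sliceUnit hx)
    (ContinuousLinearMap.proj (R := ℝ) (φ := fun _ : Fin n => ℍ) k).hasFDerivAt).differentiableAt

lemma StemDiffAt.comp_complexCoord {n : ℕ} {G : (Fin n → ℂ) → Finset (Fin n) → ℍ}
    {x : Fin n → ℍ} (hx : ∀ k, (x k).im ≠ 0) (hG : StemDiffAt G fun h => complexCoord (x h))
    (L : Finset (Fin n)) :
    DifferentiableAt ℝ (fun y : Fin n → ℍ => G (fun h => complexCoord (y h)) L) x :=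
  DifferentiableAt.comp (g := fun w => G w L) x (hG L)
    (hasFDerivAt_complexCoord_pi hx).differentiableAt

lemma StemDiffAt.induce {n : ℕ} {G : (Fin n → ℂ) → Finset (Fin n) → ℍ}
    {x : Fin n → ℍ} (hx : ∀ k, (x k).im ≠ 0) (hG : StemDiffAt G fun h => complexCoord (x h)) :
    DifferentiableAt ℝ (induce G) x := by
  unfold SliceWirtinger.induce
  exact DifferentiableAt.fun_sum fun L _ =>
    (DifferentiableAt.ordProd (fun k => differentiableAt_sliceUnit_apply (hx k)) L).mul
      (hG.comp_complexCoord hx L)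

lemma fderiv_comp_complexCoord {n : ℕ} {G : (Fin n → ℂ) → Finset (Fin n) → ℍ}
    {x : Fin n → ℍ} (hx : ∀ k, (x k).im ≠ 0) (hG : StemDiffAt G fun h => complexCoord (x h))
    (L : Finset (Fin n)) (m : Fin n) (u : ℍ) :
    fderiv ℝ (fun y : Fin n → ℍ => G (fun h => complexCoord (y h)) L) x (Pi.single m u) =
      stemDeriv (Pi.single m (complexCoordDeriv (x m) u)) G (fun h => complexCoord (x h)) L := by
  have h1 := (hG L).hasFDerivAt.comp x (hasFDerivAt_complexCoord_pi hx)
  have h2 := h1.fderiv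
  rw [Function.comp_def] at h2
  rw [h2, ContinuousLinearMap.comp_apply, stemDeriv]
  congr 1
  funext k
  by_cases hk : k = m
  · subst hk; simp
  · simp [hk]

/-- The derivative in the variable `x_m` of a slice function whose stem does not involve `m`. -/
lemma fderiv_induce_of_notMem {n : ℕ} {G : (Fin n → ℂ) → Finset (Fin n) → ℍ} {m : Fin n}
    (hm : ∀ w L, m ∈ L → G w L = 0)
    {x : Fin n → ℍ} (hx : ∀ k, (x k).im ≠ 0) (hG : StemDiffAt G fun h => complexCoord (x h))
    (u : ℍ) :
    fderiv ℝ (induce G) x (Pi.single m u) = evalAt (fun h => sliceUnit (x h))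
      (stemDeriv (Pi.single m (complexCoordDeriv (x m) u)) G fun h => complexCoord (x h)) := by
  have hd : ∀ L, DifferentiableAt ℝ (fun y : Fin n → ℍ => ordProd (fun h => sliceUnit (x h)) L *
      G (fun h => complexCoord (y h)) L) x := fun L =>
    (hG.comp_complexCoord hx L).const_mul _
  rw [fderiv_apply_eq_of_line (g := fun y => evalAt (fun h => sliceUnit (x h))
    (G fun h => complexCoord (y h))) (hG.induce hx)]
  · unfold evalAt
    rw [fderiv_fun_sum fun L _ => hd L, sum_apply]
    refine Finset.sum_congr rfl fun L _ => ?_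
    rw [fderiv_const_mul (hG.comp_complexCoord hx L), smul_apply,
      fderiv_comp_complexCoord hx hG, smul_eq_mul]
  · exact DifferentiableAt.fun_sum fun L _ => hd L
  -- Along the line only `x_m` moves: the components with `m ∈ L` vanish, and in the others no unit
  -- depends on `x_m`.
  · intro t
    refine Finset.sum_congr rfl fun L _ => ?_
    by_cases hL : m ∈ L
    · simp [hm _ L hL]
    · congr 1
      refine ordProd_congr fun k hk => ?_
      have : k ≠ m := fun e => hL (e ▸ hk)
      simp [this]

/-- Product rule for `a + J_m b`, where `a` and `b` are induced by stems free of `m`: the first term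
differentiates the stem, the second the unit. -/
lemma fderiv_induce {n : ℕ} {G : (Fin n → ℂ) → Finset (Fin n) → ℍ} {m : Fin n}
    (hs : ∀ w, SupportedFrom m.val (G w))
    {x : Fin n → ℍ} (hx : ∀ k, (x k).im ≠ 0) (hG : StemDiffAt G fun h => complexCoord (x h))
    (u : ℍ) :
    fderiv ℝ (induce G) x (Pi.single m u) = evalAt (fun h => sliceUnit (x h))
      (stemDeriv (Pi.single m (complexCoordDeriv (x m) u)) G fun h => complexCoord (x h)) +
      sliceUnitDeriv (x m) u * evalAt (fun h => sliceUnit (x h))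
        (partOn m (G fun h => complexCoord (x h))) := by
  have e : induce G = fun y => induce (fun w => partOff m (G w)) y +
      sliceUnit (y m) * induce (fun w => partOn m (G w)) y :=
    funext fun y => evalAt_split (hs _) fun h => sliceUnit (y h)
  have hs' : SupportedFrom m.val (stemDeriv (Pi.single m (complexCoordDeriv (x m) u)) G
      fun h => complexCoord (x h)) := by
    intro L hL
    have : (fun w => G w L) = fun _ => 0 := funext fun w => hs w L hL
    simp [stemDeriv, this]
  have d0 := (hG.partOff m).induce hx
  have d1 := (hG.partOn m).induce hx
  have du := (hasFDerivAt_sliceUnit (hx m)).comp x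
    (ContinuousLinearMap.proj (R := ℝ) (φ := fun _ : Fin n => ℍ) m).hasFDerivAt
  have h := d0.hasFDerivAt.add (du.mul' d1.hasFDerivAt)
  rw [e]
  refine (congrArg (fun T => T (Pi.single m u)) h.fderiv).trans ?_
  simp only [add_apply, smul_apply, fderiv_induce_of_notMem (m := m)
    (fun w L hL => by simp [partOff, hL]) hx (hG.partOff m),
    fderiv_induce_of_notMem (m := m) (fun w L hL => by simp [partOn, hL]) hx (hG.partOn m),
    partOff_stemDeriv, partOn_stemDeriv, evalAt_split hs', add_assoc]
  simp [induce, evalAt]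

/-! ### The Wirtinger operators on slice functions -/

lemma eulerIm_eq {n : ℕ} (m : Fin n) (f : (Fin n → ℍ) → ℍ) (x : Fin n → ℍ) :
    eulerIm m f x = fderiv ℝ f x (Pi.single m (x m).im) := by
  have h : ∀ u : ℍ, fderiv ℝ f x (Pi.single m u) =
      (fderiv ℝ f x).comp (ContinuousLinearMap.single ℝ (fun _ : Fin n => ℍ) m) u := fun u => rfl
  simp only [eulerIm, partialD, h, ← sum_imCoord_smul_imUnit (x m), map_sum, map_smul]

/-- The operator `½ (∂/∂x_{m0} + ε Im(x_m)⁻¹ 𝔼_{x_m})`. -/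
def globalCR {n : ℕ} (ε : ℝ) (m : Fin n) (f : (Fin n → ℍ) → ℍ) (x : Fin n → ℍ) : ℍ :=
  (1 / 2 : ℝ) • (partialD m 1 f x + ε • ((x m).im⁻¹ * eulerIm m f x))

/-- The Wirtinger operators `θ_m` (`ε = 1`) and `θ̄_m` (`ε = -1`). -/
def thetaCR {n : ℕ} (ε : ℝ) (m : Fin n) (f : (Fin n → ℍ) → ℍ) (x : Fin n → ℍ) : ℍ :=
  ∑ K ∈ (Finset.Iio m).powerset,
    ordProd (fun k => -star (x k)) (Finset.Iio m \ K) * globalCR ε m (gammaIter f m K) x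

lemma theta_eq {n : ℕ} (m : Fin n) (f : (Fin n → ℍ) → ℍ) : theta m f = thetaCR 1 m f := by
  funext x
  simp [theta, thetaCR, globalD, globalCR]

lemma thetaBar_eq {n : ℕ} (m : Fin n) (f : (Fin n → ℍ) → ℍ) :
    thetaBar m f = thetaCR (-1) m f := by
  funext x
  simp [thetaBar, thetaCR, globalDBar, globalCR, sub_eq_add_neg]

lemma inv_im_mul {q : ℍ} (hq : q.im ≠ 0) (a : ℍ) :
    q.im⁻¹ * (‖q.im‖ • a) = -(sliceUnit q * a) := by
  have hJ : sliceUnit q * sliceUnit q = -1 := sliceUnit_mem q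
  rw [inv_mul_eq_iff_eq_mul₀ hq]
  conv_rhs => rw [← norm_im_smul_sliceUnit q]
  rw [mul_neg, smul_mul_assoc, ← mul_assoc, hJ]
  simp

/-- The unit is constant in the real and the radial direction, so only the stem is differentiated.
Since `(Im x_m)⁻¹ = -J_m / |Im x_m|`, the Euler term becomes `-J_m ∂/∂β_m`, which explains the
opposite signs of `ε` in `globalCR` and `stemCR`. -/
lemma globalCR_induce {n : ℕ} {G : (Fin n → ℂ) → Finset (Fin n) → ℍ} {m : Fin n}
    (hs : ∀ w, SupportedFrom m.val (G w))
    {x : Fin n → ℍ} (hx : ∀ k, (x k).im ≠ 0) (hG : StemDiffAt G fun h => complexCoord (x h))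
    (ε : ℝ) : globalCR ε m (induce G) x = induce (stemCR ε m G) x := by
  set z : Fin n → ℂ := fun h => complexCoord (x h) with hz
  set J : Fin n → ℍ := fun h => sliceUnit (x h) with hJ
  have hs' : SupportedFrom m.val (stemDeriv (Pi.single m Complex.I) G z) := by
    intro L hL
    have : (fun w => G w L) = fun _ => 0 := funext fun w => hs w L hL
    simp [stemDeriv, this]
  have h1 : partialD m 1 (induce G) x = evalAt J (stemDeriv (Pi.single m 1) G z) := by
    rw [partialD, fderiv_induce hs hx hG, complexCoordDeriv_one, sliceUnitDeriv_one, zero_mul,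
      add_zero]
  have h2 : eulerIm m (induce G) x =
      ‖(x m).im‖ • evalAt J (stemDeriv (Pi.single m Complex.I) G z) := by
    rw [eulerIm_eq, fderiv_induce hs hx hG, complexCoordDeriv_im (hx m), sliceUnitDeriv_im (hx m),
      zero_mul, add_zero, ← evalAt_smul]
    congr 1
    funext L
    rw [stemDeriv, Pi.single_smul, map_smul]
    rfl
  change _ = evalAt J (stemCR ε m G z)
  rw [globalCR, h1, h2, inv_im_mul (hx m), stemCR, evalAt_smul, evalAt_add, evalAt_smul,
    evalAt_complexStr (J := J) hs' (sliceUnit_mem (x m))]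
  simp [hJ]

/-- The operators `L_{ij}` are tangent to the spheres `|Im x_m| = const`, so the derivatives of the
stem cancel and only those of the unit survive. -/
lemma sphericalDirac_induce {n : ℕ} {G : (Fin n → ℂ) → Finset (Fin n) → ℍ} {m : Fin n}
    (hs : ∀ w, SupportedFrom m.val (G w))
    {x : Fin n → ℍ} (hx : ∀ k, (x k).im ≠ 0) (hG : StemDiffAt G fun h => complexCoord (x h)) :
    (2 * (x m).im)⁻¹ * sphericalDirac m (induce G) x = induce (fun w => sphVec m w (G w)) x := by
  set z : Fin n → ℂ := fun h => complexCoord (x h) with hz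
  set J : Fin n → ℍ := fun h => sliceUnit (x h) with hJ
  set b := evalAt J (partOn m (G z)) with hb
  set β := ‖(x m).im‖ with hβ
  have ht : ∀ i j, tangentialD m i j (induce G) x =
      β⁻¹ • ((imCoord i (x m) • imUnit j - imCoord j (x m) • imUnit i) * b) := by
    intro i j
    have hd : ∀ i, partialD m (imUnit i) (induce G) x =
        (β⁻¹ * imCoord i (x m)) • evalAt J (stemDeriv (Pi.single m Complex.I) G z) +
          (β⁻¹ • imUnit i + (-(β ^ 2)⁻¹ * (β⁻¹ * imCoord i (x m))) • (x m).im) * b := by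
      intro i
      rw [partialD, fderiv_induce hs hx hG, complexCoordDeriv_imUnit, sliceUnitDeriv_imUnit,
        ← evalAt_smul]
      congr 2
      funext L
      rw [stemDeriv, Pi.single_smul, map_smul]
      rfl
    rw [tangentialD, hd, hd]
    simp only [add_mul, sub_mul, smul_mul_assoc]
    module
  have h0 : sphericalDirac m (induce G) x = 2 * (x m).im * (β⁻¹ • b) := by
    have := imUnit_dirac_sum (x m) b
    simp only [sphericalDirac, ht, mul_smul_comm, ← Finset.smul_sum]
    rw [this, mul_assoc, two_mul]
    module
  have h2 : (2 : ℍ) ≠ 0 := fun h => by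
    rw [← one_add_one_eq_two] at h
    have := congrArg (fun q : ℍ => q.re) h
    simp only [Quaternion.re_add, Quaternion.re_one, Quaternion.re_zero] at this
    norm_num at this
  change _ = evalAt J (sphVec m z (G z))
  rw [h0, inv_mul_cancel_left₀ (mul_ne_zero h2 (hx m)), sphVec, evalAt_smul]
  rfl

lemma mul_induce {n : ℕ} {G : (Fin n → ℂ) → Finset (Fin n) → ℍ} {m : Fin n}
    (hs : ∀ w, SupportedFrom m.val (G w)) (x : Fin n → ℍ) :
    x m * induce G x = induce (fun w => mulVec m w (G w)) x := by
  have := evalAt_mulVec (hs fun h => complexCoord (x h)) (J := fun h => sliceUnit (x h))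
    (sliceUnit_mem (x m)) fun h => complexCoord (x h)
  rw [slicePoint_sliceUnit] at this
  exact this.symm

lemma sphericalDirac_congr {n : ℕ} {m : Fin n} {f g : (Fin n → ℍ) → ℍ} {x : Fin n → ℍ}
    (h : f =ᶠ[nhds x] g) : sphericalDirac m f x = sphericalDirac m g x := by
  simp only [sphericalDirac, tangentialD, partialD, h.fderiv_eq]

lemma globalCR_congr {n : ℕ} {ε : ℝ} {m : Fin n} {f g : (Fin n → ℍ) → ℍ} {x : Fin n → ℍ}
    (h : f =ᶠ[nhds x] g) : globalCR ε m f x = globalCR ε m g x := by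
  simp only [globalCR, eulerIm, partialD, h.fderiv_eq]

lemma complexCoord_im_ne {q : ℍ} (hq : q.im ≠ 0) : (complexCoord q).im ≠ 0 :=
  norm_ne_zero_iff.2 hq

/-- Equality on an open set, rather than at a point, is what lets each step differentiate the
previous one. Differentiability of `G` suffices for all iterates, since `gammaVec` contains no
derivative of `G`. -/
lemma gammaIter_eqOn {n : ℕ} {U : Set (Fin n → ℍ)} (hU : IsOpen U)
    (hx : ∀ x ∈ U, ∀ k, (x k).im ≠ 0) {G : (Fin n → ℂ) → Finset (Fin n) → ℍ}
    (hG : ∀ x ∈ U, StemDiffAt G fun h => complexCoord (x h)) {f : (Fin n → ℍ) → ℍ}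
    (hf : Set.EqOn f (induce G) U) {m : ℕ} (hm : m ≤ n) (K : Finset (Fin n)) :
    Set.EqOn (gammaIter f m K) (induce fun w => gammaVec w (G w) m K) U := by
  induction m generalizing K with
  | zero => exact hf
  | succ m ih =>
    intro x hxU
    have hmn : m < n := hm
    have hs : ∀ K w, SupportedFrom m (gammaVec w (G w) m K) := fun K w =>
      gammaVec_supportedFrom w _ m K
    have hd := (hG x hxU).gammaVec (fun k => complexCoord_im_ne (hx x hxU k)) m
      (K.erase ⟨m, hmn⟩)
    have hev : ∀ y ∈ U, gammaIter f m (K.erase ⟨m, hmn⟩) y =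
      induce (fun w => gammaVec w (G w) m (K.erase ⟨m, hmn⟩)) y := fun y hy => ih hmn.le _ hy
    simp only [gammaIter, gammaVec, dif_pos hmn]
    split_ifs with hK
    · rw [← sphericalDirac_induce (m := ⟨m, hmn⟩) (fun w => (hs _ w).mulVec le_rfl w) (hx x hxU)
        (hd.mulVec _)]
      congr 1
      refine sphericalDirac_congr ?_
      filter_upwards [hU.mem_nhds hxU] with y hy
      rw [hev y hy, mul_induce (m := ⟨m, hmn⟩) (hs _)]
    · rw [← sphericalDirac_induce (m := ⟨m, hmn⟩) (hs _) (hx x hxU) hd]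
      congr 1
      refine sphericalDirac_congr ?_
      filter_upwards [hU.mem_nhds hxU] with y hy
      rw [hev y hy, one_mul]

theorem thetaCR_eqOn {n : ℕ} {U : Set (Fin n → ℍ)} (hU : IsOpen U)
    (hx : ∀ x ∈ U, ∀ k, (x k).im ≠ 0) {G : (Fin n → ℂ) → Finset (Fin n) → ℍ}
    (hG : ∀ x ∈ U, StemDiffAt G fun h => complexCoord (x h)) {f : (Fin n → ℍ) → ℍ}
    (hf : Set.EqOn f (induce G) U) (ε : ℝ) (m : Fin n) :
    Set.EqOn (thetaCR ε m f) (induce (stemCR ε m G)) U := by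
  intro x hxU
  have hz : ∀ k, (complexCoord (x k)).im ≠ 0 := fun k => complexCoord_im_ne (hx x hxU k)
  have hI : Finset.Iio m = Finset.univ.filter fun k : Fin n => k.val < m.val := by
    ext k; simp
  have h := evalAt_eq_sum_gammaVec (z := fun h => complexCoord (x h)) hz
    (J := fun h => sliceUnit (x h)) (fun k => sliceUnit_mem (x k))
    (stemCR ε m G fun h => complexCoord (x h)) m.isLt.le
  rw [slicePoint_sliceUnit, ← hI] at h
  refine Eq.trans ?_ h.symm
  refine Finset.sum_congr rfl fun K _ => ?_
  congr 1
  rw [globalCR_congr ((gammaIter_eqOn hU hx hG hf m.isLt.le K).eventuallyEq_of_mem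
    (hU.mem_nhds hxU)), globalCR_induce (fun w => gammaVec_supportedFrom w _ m K) (hx x hxU)
    ((hG x hxU).gammaVec hz m K)]
  rw [← stemCR_gammaVec (hG x hxU) hz ε le_rfl]
  rfl

/-! ### Stems off the real locus -/

lemma IsSlice.isStem_stemOf {n : ℕ} {D : Set (Fin n → ℂ)} {f : (Fin n → ℍ) → ℍ}
    (h : IsSlice D f) : IsStem D (stemOf D f) := by
  rw [stemOf, dif_pos h]; exact h.choose_spec.1

lemma IsSlice.isInduced_stemOf {n : ℕ} {D : Set (Fin n → ℂ)} {f : (Fin n → ℍ) → ℍ}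
    (h : IsSlice D f) : IsInduced D (stemOf D f) f := by
  rw [stemOf, dif_pos h]; exact h.choose_spec.2

lemma stemOf_eq {n : ℕ} {D : Set (Fin n → ℂ)} {f : (Fin n → ℍ) → ℍ}
    {F : (Fin n → ℂ) → Finset (Fin n) → ℍ} (hF : IsStem D F) (hf : IsInduced D F f)
    {z : Fin n → ℂ} (hz : z ∈ D) : stemOf D f z = F z :=
  stem_unique (IsSlice.isInduced_stemOf ⟨F, hF, hf⟩) hf hz

lemma ConjInvariant.offReal {n : ℕ} {D : Set (Fin n → ℂ)} (hD : ConjInvariant D) :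
    ConjInvariant (offReal D) := by
  rintro z ⟨hz, hne⟩ h
  refine ⟨hD z hz h, fun k => ?_⟩
  by_cases hk : k = h
  · subst hk; simpa [conjAt] using hne k
  · simpa [conjAt, hk] using hne k

lemma IsStem.mono {n : ℕ} {D D' : Set (Fin n → ℂ)} (h : D' ⊆ D)
    {F : (Fin n → ℂ) → Finset (Fin n) → ℍ} (hF : IsStem D F) : IsStem D' F :=
  fun z hz => hF z (h hz)

lemma IsInduced.mono {n : ℕ} {D D' : Set (Fin n → ℂ)} (h : D' ⊆ D)
    {F : (Fin n → ℂ) → Finset (Fin n) → ℍ} {f : (Fin n → ℍ) → ℍ} (hF : IsInduced D F f) :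
    IsInduced D' F f := fun z hz => hF z (h hz)

lemma offReal_subset {n : ℕ} (D : Set (Fin n → ℂ)) : offReal D ⊆ D := fun _ h => h.1

/-- Two representations of a point have the same real parts and imaginary parts equal up to sign, so
they differ by conjugations of coordinates. -/
lemma slicePoint_mem_circularSet_iff {n : ℕ} {D : Set (Fin n → ℂ)} (hD : ConjInvariant D)
    {z : Fin n → ℂ} {J : Fin n → ℍ} (hJ : ∀ h, J h ∈ imSphere) :
    slicePoint z J ∈ circularSet D ↔ z ∈ D := by
  refine ⟨?_, fun hz => ⟨z, hz, J, hJ, rfl⟩⟩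
  rintro ⟨w, hw, I, hI, e⟩
  -- The zero stem serves only to read off from `stem_flip` that `D` is stable under several
  -- conjugations.
  have h0 : IsStem D (fun _ _ => 0) := fun _ _ _ _ => by simp
  have h1 := (stem_flip hD h0 hw (Finset.univ.filter fun k => (z k).im ≠ (w k).im)).1
  convert h1 using 1
  funext k
  have hre : (z k).re = (w k).re := by
    rw [← slicePoint_re z (hJ k), ← slicePoint_re w (hI k), e]
  have him : |(z k).im| = |(w k).im| := by
    have := congrArg norm ((slicePoint_im z (hJ k)).symm.trans
      ((congrArg (fun x : Fin n → ℍ => (x k).im) e).trans (slicePoint_im w (hI k))))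
    simpa [norm_smul, imSphere_norm (hJ k), imSphere_norm (hI k)] using this
  by_cases hk : (z k).im = (w k).im
  · simp only [Finset.mem_filter, Finset.mem_univ, true_and, hk, ne_eq, not_true_eq_false, if_false]
    exact Complex.ext hre hk
  · simp only [Finset.mem_filter, Finset.mem_univ, true_and, hk, ne_eq, not_false_eq_true, if_true]
    refine Complex.ext hre ?_
    simpa using (abs_eq_abs.1 him).resolve_left hk

lemma complexCoord_mem {n : ℕ} {D : Set (Fin n → ℂ)} (hD : ConjInvariant D) {x : Fin n → ℍ}
    (hx : x ∈ circularSet D) : (fun h => complexCoord (x h)) ∈ D := by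
  rw [← slicePoint_sliceUnit x] at hx
  exact (slicePoint_mem_circularSet_iff hD fun k => sliceUnit_mem (x k)).1 hx

lemma IsInduced.eqOn {n : ℕ} {D : Set (Fin n → ℂ)} (hD : ConjInvariant D)
    {F : (Fin n → ℂ) → Finset (Fin n) → ℍ} {f : (Fin n → ℍ) → ℍ} (hf : IsInduced D F f) :
    Set.EqOn f (induce F) (circularSet D) := by
  intro x hx
  have := hf _ (complexCoord_mem hD hx) (fun h => sliceUnit (x h)) fun k => sliceUnit_mem (x k)
  rwa [slicePoint_sliceUnit] at this

lemma isInduced_of_eqOn {n : ℕ} {D : Set (Fin n → ℂ)} (hD : ConjInvariant D)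
    {F : (Fin n → ℂ) → Finset (Fin n) → ℍ} (hF : IsStem D F) {f : (Fin n → ℍ) → ℍ}
    (hf : Set.EqOn f (induce F) (circularSet D)) : IsInduced D F f := by
  intro z hz J hJ
  rw [hf ⟨z, hz, J, hJ, rfl⟩]
  exact isInduced_induce hD hF z hz J hJ

lemma isClosed_realLocus (n : ℕ) : IsClosed (realLocus n) := by
  have : realLocus n = ⋃ k : Fin n, {x : Fin n → ℍ | (x k).im = 0} := by
    ext x; simp [realLocus]
  rw [this]
  exact isClosed_iUnion_of_finite fun k =>
    isClosed_eq (Quaternion.continuous_im.comp (continuous_apply k)) continuous_const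

lemma contDiff_slicePoint {n : ℕ} {r : WithTop ℕ∞} (J : Fin n → ℍ) :
    ContDiff ℝ r fun z : Fin n → ℂ => slicePoint z J := by
  rw [contDiff_pi]
  intro k
  have h1 : ContDiff ℝ r fun z : Fin n → ℂ => (z k).re :=
    (Complex.reCLM.comp
      (ContinuousLinearMap.proj (R := ℝ) (φ := fun _ : Fin n => ℂ) k)).contDiff
  have h2 : ContDiff ℝ r fun z : Fin n → ℂ => (z k).im :=
    (Complex.imCLM.comp
      (ContinuousLinearMap.proj (R := ℝ) (φ := fun _ : Fin n => ℂ) k)).contDiff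
  have e : (fun z : Fin n → ℂ => slicePoint z J k) =
      fun z => (z k).re • (1 : ℍ) + (z k).im • J k := by
    funext z
    rw [slicePoint, ← Quaternion.coe_commutes, Quaternion.coe_mul_eq_smul, ← mul_one ((z k).re : ℍ),
      Quaternion.coe_mul_eq_smul]
  rw [e]
  exact (h1.smul contDiff_const).add (h2.smul contDiff_const)

lemma isOpen_of_isOpen_circularSet {n : ℕ} {D : Set (Fin n → ℂ)} (hD : ConjInvariant D)
    (h : IsOpen (circularSet D)) : IsOpen D := by
  -- Any fixed unit would do; `sliceUnit 0` is a convenient one.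
  have e : D = (fun z : Fin n → ℂ => slicePoint z fun _ => sliceUnit 0) ⁻¹' circularSet D := by
    ext z
    exact (slicePoint_mem_circularSet_iff hD fun _ => sliceUnit_mem 0).symm
  rw [e]
  exact h.preimage (contDiff_slicePoint (r := 0) _).continuous

/-- Orthogonality of the characters of the group of sign changes: the sum factors over the indices,
and an index in exactly one of `K`, `L` gives the factor `1 - 1`. -/
lemma sum_sign_mul_sign {n : ℕ} (K L : Finset (Fin n)) : ∑ S : Finset (Fin n),
    (∏ k ∈ L, if k ∈ S then (-1 : ℝ) else 1) * (∏ k ∈ K, if k ∈ S then (-1 : ℝ) else 1) =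
      if K = L then 2 ^ n else 0 := by
  have sw : ∀ A B : Finset (Fin n), (∏ k ∈ A, if k ∈ B then (-1 : ℝ) else 1) =
      ∏ k ∈ B, if k ∈ A then (-1 : ℝ) else 1 := by
    intro A B
    rw [Finset.prod_ite_mem, Finset.prod_ite_mem, Finset.inter_comm]
  simp only [sw L, sw K, ← Finset.prod_mul_distrib]
  rw [← Finset.powerset_univ, ← Finset.prod_one_add]
  split_ifs with hKL
  · subst hKL
    have : ∀ k : Fin n, 1 + (if k ∈ K then (-1 : ℝ) else 1) * (if k ∈ K then (-1 : ℝ) else 1)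
        = 2 := by intro k; split_ifs <;> norm_num
    rw [Finset.prod_congr rfl fun k _ => this k]
    simp
  · obtain ⟨a, ha⟩ : ∃ a, ¬(a ∈ K ↔ a ∈ L) := by
      by_contra hcon
      push Not at hcon
      exact hKL (Finset.ext hcon)
    refine Finset.prod_eq_zero (Finset.mem_univ a) ?_
    by_cases h1 : a ∈ K <;> by_cases h2 : a ∈ L <;> simp_all

/-- The components of the stem are linear combinations of values of the slice function. -/
lemma IsInduced.stem_apply_eq {n : ℕ} {D : Set (Fin n → ℂ)}
    {F : (Fin n → ℂ) → Finset (Fin n) → ℍ} {f : (Fin n → ℍ) → ℍ} (hf : IsInduced D F f)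
    {J : Fin n → ℍ} (hJ : ∀ h, J h ∈ imSphere) {z : Fin n → ℂ} (hz : z ∈ D)
    (L : Finset (Fin n)) :
    F z L = (ordProd J L)⁻¹ * (((2 : ℝ) ^ n)⁻¹ • ∑ S : Finset (Fin n),
      (∏ k ∈ L, if k ∈ S then (-1 : ℝ) else 1) •
        f (slicePoint z fun k => (if k ∈ S then (-1 : ℝ) else 1) • J k)) := by
  have h1 : ∀ S : Finset (Fin n),
      f (slicePoint z fun k => (if k ∈ S then (-1 : ℝ) else 1) • J k) =
        ∑ K, (∏ k ∈ K, if k ∈ S then (-1 : ℝ) else 1) • (ordProd J K * F z K) := by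
    intro S
    rw [hf z hz]
    · refine Finset.sum_congr rfl fun K _ => ?_
      rw [ordProd_smul, smul_mul_assoc]
    · intro h
      split_ifs
      · simpa using neg_mem_imSphere (hJ h)
      · simpa using hJ h
  have hne : ordProd J L ≠ 0 := by
    have : ∀ k, J k ≠ 0 := fun k h => by simpa [h] using imSphere_norm (hJ k)
    simp [ordProd, this]
  simp only [h1, Finset.smul_sum]
  rw [Finset.sum_comm]
  simp only [smul_smul, ← Finset.sum_smul, ← Finset.mul_sum, sum_sign_mul_sign]
  simp [hne]

/-- For a fixed unit the map `z ↦ slicePoint z J` is affine in real coordinates, so the inversion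
formula transfers the regularity of `f` to its stem. -/
lemma IsInduced.contDiffOn_stem {n : ℕ} {D : Set (Fin n → ℂ)}
    {F : (Fin n → ℂ) → Finset (Fin n) → ℍ} {f : (Fin n → ℍ) → ℍ} (hf : IsInduced D F f)
    {r : WithTop ℕ∞} (h : ContDiffOn ℝ r f (circularSet D)) (L : Finset (Fin n)) :
    ContDiffOn ℝ r (fun z => F z L) D := by
  have hJ : ∀ S : Finset (Fin n), ∀ k,
      (if k ∈ S then (-1 : ℝ) else 1) • sliceUnit 0 ∈ imSphere := by
    intro S k
    split_ifs
    · simpa using neg_mem_imSphere (sliceUnit_mem 0)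
    · simpa using sliceUnit_mem 0
  refine ContDiffOn.congr ?_ fun z hz =>
    hf.stem_apply_eq (J := fun _ => sliceUnit 0) (fun _ => sliceUnit_mem 0) hz L
  refine contDiffOn_const.mul (ContDiffOn.const_smul _ (ContDiffOn.sum fun S _ =>
    ContDiffOn.const_smul _ ?_))
  exact h.comp (contDiff_slicePoint _).contDiffOn fun z hz => ⟨z, hz, _, hJ S, rfl⟩

lemma continuousOn_induce {n : ℕ} {D : Set (Fin n → ℂ)} (hD : ConjInvariant D) (hDo : IsOpen D)
    (him : ∀ z ∈ D, ∀ k, (z k).im ≠ 0) {G : (Fin n → ℂ) → Finset (Fin n) → ℍ}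
    (hG : ∀ L, ContinuousOn (fun z => G z L) D) : ContinuousOn (induce G) (circularSet D) := by
  intro x hx
  have hz := complexCoord_mem hD hx
  have hne : ∀ k, (x k).im ≠ 0 := by
    intro k h
    refine him _ hz k ?_
    simp [complexCoord, h]
  refine ContinuousAt.continuousWithinAt ?_
  unfold induce
  refine tendsto_finsetSum _ fun L _ => ?_
  refine Filter.Tendsto.mul (DifferentiableAt.ordProd (fun k =>
    differentiableAt_sliceUnit_apply (hne k)) L).continuousAt ?_
  exact ContinuousAt.comp (g := fun w => G w L) ((hG L).continuousAt (hDo.mem_nhds hz))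
    (hasFDerivAt_complexCoord_pi hne).continuousAt

/-! ### Parity of the derivatives of a stem -/

/-- Conjugation of the `h`-th coordinate as a continuous linear map. -/
def conjAtCLM {n : ℕ} (h : Fin n) : (Fin n → ℂ) →L[ℝ] (Fin n → ℂ) :=
  ContinuousLinearMap.pi fun k => if k = h then
    (Complex.conjCLE : ℂ →L[ℝ] ℂ).comp
      (ContinuousLinearMap.proj (R := ℝ) (φ := fun _ : Fin n => ℂ) k)
    else ContinuousLinearMap.proj k

lemma conjAtCLM_apply {n : ℕ} (h : Fin n) (z : Fin n → ℂ) : conjAtCLM h z = conjAt h z := by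
  funext k
  by_cases hk : k = h
  · subst hk; simp [conjAtCLM, conjAt]
  · simp [conjAtCLM, conjAt, hk]

lemma conjAt_single_one {n : ℕ} (h m : Fin n) :
    conjAt h (Pi.single m (1 : ℂ)) = Pi.single m 1 := by
  funext k
  by_cases hk : k = h
  · subst hk
    by_cases hm : k = m
    · subst hm; simp [conjAt]
    · simp [conjAt, hm]
  · simp [conjAt, hk]

lemma conjAt_single_I {n : ℕ} (h m : Fin n) :
    conjAt h (Pi.single m Complex.I) = (if m = h then (-1 : ℝ) else 1) • Pi.single m Complex.I := by
  funext k
  by_cases hk : k = h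
  · subst hk
    by_cases hm : k = m
    · subst hm; simp [conjAt]
    · simp [conjAt, hm, Ne.symm hm]
  · by_cases hm : k = m
    · subst hm; simp [conjAt, hk]
    · simp [conjAt, hk, hm]

/-- Chain rule applied to the parity relation, which holds near `conjAt h z` because `D` is open. -/
lemma IsStem.stemDeriv_conjAt {n : ℕ} {D : Set (Fin n → ℂ)} (hD : ConjInvariant D)
    (hDo : IsOpen D) {F : (Fin n → ℂ) → Finset (Fin n) → ℍ} (hF : IsStem D F)
    (hd : ∀ z ∈ D, StemDiffAt F z) {z : Fin n → ℂ} (hz : z ∈ D) (h : Fin n) (v : Fin n → ℂ)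
    (K : Finset (Fin n)) :
    stemDeriv v F (conjAt h z) K =
      (if h ∈ K then (-1 : ℝ) else 1) • stemDeriv (conjAt h v) F z K := by
  have e : (fun w => F w K) =ᶠ[nhds (conjAt h z)]
      fun w => (if h ∈ K then (-1 : ℝ) else 1) • F (conjAtCLM h w) K := by
    filter_upwards [hDo.mem_nhds (hD z hz h)] with w hw
    rw [conjAtCLM_apply, hF w hw]
    split_ifs <;> simp
  have hz' : conjAtCLM h (conjAt h z) = z := by rw [conjAtCLM_apply, conjAt_conjAt]
  have h1 : HasFDerivAt (fun w => F w K) (fderiv ℝ (fun w => F w K) z)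
      (conjAtCLM h (conjAt h z)) := by rw [hz']; exact (hd z hz K).hasFDerivAt
  have h2 := ((h1.comp (conjAt h z) (conjAtCLM h).hasFDerivAt).const_smul
    (if h ∈ K then (-1 : ℝ) else 1)).congr_of_eventuallyEq e
  rw [stemDeriv, h2.fderiv, smul_apply, ContinuousLinearMap.comp_apply, conjAtCLM_apply]
  rfl

/-- For `m = h`, conjugation reverses `∂/∂β_m`, and `complexStr m` exchanges the sets with and
without `m`; the two changes of parity cancel. -/
lemma IsStem.stemCR {n : ℕ} {D : Set (Fin n → ℂ)} (hD : ConjInvariant D)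
    (hDo : IsOpen D) {F : (Fin n → ℂ) → Finset (Fin n) → ℍ} (hF : IsStem D F)
    (hd : ∀ z ∈ D, StemDiffAt F z) (ε : ℝ) (m : Fin n) : IsStem D (stemCR ε m F) := by
  intro z hz K h
  have h1 : ∀ K, stemDeriv (Pi.single m 1) F (conjAt h z) K =
      (if h ∈ K then (-1 : ℝ) else 1) • stemDeriv (Pi.single m 1) F z K := fun K => by
    rw [hF.stemDeriv_conjAt hD hDo hd hz, conjAt_single_one]
  have h2 : ∀ K, stemDeriv (Pi.single m Complex.I) F (conjAt h z) K =
      ((if h ∈ K then (-1 : ℝ) else 1) * (if m = h then (-1 : ℝ) else 1)) •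
        stemDeriv (Pi.single m Complex.I) F z K := fun K => by
    rw [hF.stemDeriv_conjAt hD hDo hd hz, conjAt_single_I, mul_smul]
    congr 1
    simp only [stemDeriv, map_smul]
  have h3 : complexStr m (stemDeriv (Pi.single m Complex.I) F (conjAt h z)) K =
      (if h ∈ K then (-1 : ℝ) else 1) •
        complexStr m (stemDeriv (Pi.single m Complex.I) F z) K := by
    rw [complexStr_eq_toggle, complexStr_eq_toggle, h2, smul_comm]
    congr 1
    simp only [mem_toggle]
    by_cases hmh : m = h
    · subst hmh
      by_cases hK : m ∈ K <;> simp [hK]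
    · simp [hmh, Ne.symm hmh]
  have h4 : SliceWirtinger.stemCR ε m F (conjAt h z) K =
      (if h ∈ K then (-1 : ℝ) else 1) • SliceWirtinger.stemCR ε m F z K := by
    simp only [SliceWirtinger.stemCR, Pi.smul_apply, Pi.add_apply, h1, h3]
    module
  rw [h4]
  split_ifs <;> simp

/-! ### Commutation and product rule for stems -/

lemma continuousOn_stemDeriv {n : ℕ} {D : Set (Fin n → ℂ)} (hDo : IsOpen D)
    {F : (Fin n → ℂ) → Finset (Fin n) → ℍ} (hF : ∀ L, ContDiffOn ℝ 1 (fun z => F z L) D)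
    (v : Fin n → ℂ) (L : Finset (Fin n)) : ContinuousOn (fun z => stemDeriv v F z L) D :=
  ((hF L).continuousOn_fderiv_of_isOpen hDo le_rfl).clm_apply continuousOn_const

lemma continuousOn_stemCR {n : ℕ} {D : Set (Fin n → ℂ)} (hDo : IsOpen D)
    {F : (Fin n → ℂ) → Finset (Fin n) → ℍ} (hF : ∀ L, ContDiffOn ℝ 1 (fun z => F z L) D)
    (ε : ℝ) (m : Fin n) (L : Finset (Fin n)) : ContinuousOn (fun z => stemCR ε m F z L) D := by
  simp only [stemCR, Pi.smul_apply, Pi.add_apply, complexStr_eq_toggle]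
  exact ((continuousOn_stemDeriv hDo hF _ L).add
    (((continuousOn_stemDeriv hDo hF _ _).const_smul (if m ∈ L then (1 : ℝ) else -1)).const_smul
      (-ε))).const_smul (1 / 2 : ℝ)

lemma stemDiffAt_of_contDiffOn {n : ℕ} {D : Set (Fin n → ℂ)} (hDo : IsOpen D)
    {F : (Fin n → ℂ) → Finset (Fin n) → ℍ} (hF : ∀ L, ContDiffOn ℝ 1 (fun z => F z L) D)
    {z : Fin n → ℂ} (hz : z ∈ D) : StemDiffAt F z := fun L =>
  ((hF L).contDiffAt (hDo.mem_nhds hz)).differentiableAt one_ne_zero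

lemma stemDiffAt_stemDeriv {n : ℕ} {D : Set (Fin n → ℂ)} (hDo : IsOpen D)
    {F : (Fin n → ℂ) → Finset (Fin n) → ℍ} (hF : ∀ L, ContDiffOn ℝ 2 (fun z => F z L) D)
    {z : Fin n → ℂ} (hz : z ∈ D) (v : Fin n → ℂ) : StemDiffAt (stemDeriv v F) z := fun L =>
  (((hF L).contDiffAt (hDo.mem_nhds hz)).fderiv_right (m := 1) (by norm_num)).differentiableAt
    one_ne_zero |>.clm_apply (differentiableAt_const _)

lemma StemDiffAt.const_smul {n : ℕ} {G : (Fin n → ℂ) → Finset (Fin n) → ℍ} {z : Fin n → ℂ}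
    (hG : StemDiffAt G z) (r : ℝ) : StemDiffAt (fun w => r • G w) z :=
  hG.smul (differentiableAt_const r)

lemma stemDeriv_const_smul {n : ℕ} {G : (Fin n → ℂ) → Finset (Fin n) → ℍ} {z : Fin n → ℂ}
    (hG : StemDiffAt G z) (r : ℝ) (v : Fin n → ℂ) :
    stemDeriv v (fun w => r • G w) z = r • stemDeriv v G z :=
  stemDeriv_smul hG (differentiableAt_const r) fun _ => rfl

lemma stemDiffAt_stemCR {n : ℕ} {D : Set (Fin n → ℂ)} (hDo : IsOpen D)
    {F : (Fin n → ℂ) → Finset (Fin n) → ℍ} (hF : ∀ L, ContDiffOn ℝ 2 (fun z => F z L) D)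
    {z : Fin n → ℂ} (hz : z ∈ D) (ε : ℝ) (m : Fin n) : StemDiffAt (stemCR ε m F) z :=
  ((stemDiffAt_stemDeriv hDo hF hz _).add
    (((stemDiffAt_stemDeriv hDo hF hz _).complexStr m).const_smul _)).const_smul _

lemma stemDeriv_stemCR {n : ℕ} {D : Set (Fin n → ℂ)} (hDo : IsOpen D)
    {F : (Fin n → ℂ) → Finset (Fin n) → ℍ} (hF : ∀ L, ContDiffOn ℝ 2 (fun z => F z L) D)
    {z : Fin n → ℂ} (hz : z ∈ D) (ε : ℝ) (m : Fin n) (v : Fin n → ℂ) :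
    stemDeriv v (stemCR ε m F) z = (1 / 2 : ℝ) • (stemDeriv v (stemDeriv (Pi.single m 1) F) z +
      (-ε) • complexStr m (stemDeriv v (stemDeriv (Pi.single m Complex.I) F) z)) := by
  have h1 := stemDiffAt_stemDeriv hDo hF hz (Pi.single m 1)
  have h2 := (stemDiffAt_stemDeriv hDo hF hz (Pi.single m Complex.I)).complexStr m
  unfold stemCR
  rw [stemDeriv_const_smul (h1.add (h2.const_smul _)), stemDeriv_add h1 (h2.const_smul _),
    stemDeriv_const_smul h2, complexStr_stemDeriv]

lemma stemDeriv_comm {n : ℕ} {D : Set (Fin n → ℂ)} (hDo : IsOpen D)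
    {F : (Fin n → ℂ) → Finset (Fin n) → ℍ} (hF : ∀ L, ContDiffOn ℝ 2 (fun z => F z L) D)
    {z : Fin n → ℂ} (hz : z ∈ D) (u v : Fin n → ℂ) :
    stemDeriv u (stemDeriv v F) z = stemDeriv v (stemDeriv u F) z := by
  funext L
  have hc := (hF L).contDiffAt (hDo.mem_nhds hz)
  have hs := hc.isSymmSndFDerivAt (by simp) u v
  have hd := (hc.fderiv_right (m := 1) (by norm_num)).differentiableAt one_ne_zero
  have e : ∀ a b : Fin n → ℂ, stemDeriv a (stemDeriv b F) z L =
      fderiv ℝ (fderiv ℝ fun w => F w L) z a b := by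
    intro a b
    simp only [stemDeriv]
    rw [fderiv_clm_apply hd (differentiableAt_const _)]
    simp
  rw [e, e, hs]

theorem stemCR_comm {n : ℕ} {D : Set (Fin n → ℂ)} (hDo : IsOpen D)
    {F : (Fin n → ℂ) → Finset (Fin n) → ℍ} (hF : ∀ L, ContDiffOn ℝ 2 (fun z => F z L) D)
    {z : Fin n → ℂ} (hz : z ∈ D) (ε δ : ℝ) (l m : Fin n) :
    stemCR ε l (stemCR δ m F) z = stemCR δ m (stemCR ε l F) z := by
  rw [stemCR, stemCR, stemDeriv_stemCR hDo hF hz, stemDeriv_stemCR hDo hF hz,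
    stemDeriv_stemCR hDo hF hz, stemDeriv_stemCR hDo hF hz]
  simp only [complexStr_add, complexStr_smul, complexStr_comm l m,
    stemDeriv_comm hDo hF hz (Pi.single l _) (Pi.single m _)]
  module

lemma hasFDerivAt_tensorMul {n : ℕ} {F G : (Fin n → ℂ) → Finset (Fin n) → ℍ} {z : Fin n → ℂ}
    (hF : StemDiffAt F z) (hG : StemDiffAt G z) (L : Finset (Fin n)) :
    HasFDerivAt (fun w => tensorMul (F w) (G w) L)
      (∑ H, ∑ K, if symmDiff H K = L then ((-1 : ℝ) ^ (H ∩ K).card) •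
        (F z H • fderiv ℝ (fun w => G w K) z +
          MulOpposite.op (G z K) • fderiv ℝ (fun w => F w H) z) else 0) z := by
  simp only [tensorMul_apply_eq]
  refine HasFDerivAt.fun_sum fun H _ => HasFDerivAt.fun_sum fun K _ => ?_
  split_ifs
  · exact ((hF H).hasFDerivAt.mul' (hG K).hasFDerivAt).const_smul ((-1 : ℝ) ^ (H ∩ K).card)
  · exact hasFDerivAt_const _ _

lemma StemDiffAt.tensorMul {n : ℕ} {F G : (Fin n → ℂ) → Finset (Fin n) → ℍ} {z : Fin n → ℂ}
    (hF : StemDiffAt F z) (hG : StemDiffAt G z) :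
    StemDiffAt (fun w => tensorMul (F w) (G w)) z := fun L =>
  (hasFDerivAt_tensorMul hF hG L).differentiableAt

lemma stemDeriv_tensorMul {n : ℕ} {F G : (Fin n → ℂ) → Finset (Fin n) → ℍ} {z : Fin n → ℂ}
    (hF : StemDiffAt F z) (hG : StemDiffAt G z) (v : Fin n → ℂ) :
    stemDeriv v (fun w => tensorMul (F w) (G w)) z =
      tensorMul (stemDeriv v F z) (G z) + tensorMul (F z) (stemDeriv v G z) := by
  funext L
  rw [stemDeriv, (hasFDerivAt_tensorMul hF hG L).fderiv, Pi.add_apply, tensorMul_apply_eq,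
    tensorMul_apply_eq, ← Finset.sum_add_distrib, sum_apply]
  refine Finset.sum_congr rfl fun H _ => ?_
  rw [← Finset.sum_add_distrib, sum_apply]
  refine Finset.sum_congr rfl fun K _ => ?_
  split_ifs
  · simp [stemDeriv, add_comm]
  · simp

theorem stemCR_tensorMul {n : ℕ} {F G : (Fin n → ℂ) → Finset (Fin n) → ℍ} {z : Fin n → ℂ}
    (hF : StemDiffAt F z) (hG : StemDiffAt G z) (ε : ℝ) (m : Fin n) :
    stemCR ε m (fun w => tensorMul (F w) (G w)) z =
      tensorMul (stemCR ε m F z) (G z) + tensorMul (F z) (stemCR ε m G z) := by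
  simp only [stemCR, stemDeriv_tensorMul hF hG, tensorMul_add_left, tensorMul_add_right,
    tensorMul_smul_left, tensorMul_smul_right, tensorMul_complexStr_left,
    tensorMul_complexStr_right, complexStr_add]
  module

/-! ### The Wirtinger operators as slice partial derivatives -/

lemma im_ne_zero_of_mem {n : ℕ} {D : Set (Fin n → ℂ)} {x : Fin n → ℍ}
    (hx : x ∈ circularSet (offReal D)) (k : Fin n) : (x k).im ≠ 0 := by
  rw [circularSet_offReal] at hx
  exact fun h => hx.2 ⟨k, h⟩

lemma isOpen_circularSet_offReal {n : ℕ} {D : Set (Fin n → ℂ)} (hΩ : IsOpen (circularSet D)) :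
    IsOpen (circularSet (offReal D)) := by
  rw [circularSet_offReal]
  exact hΩ.sdiff (isClosed_realLocus n)

lemma isOpen_offReal {n : ℕ} {D : Set (Fin n → ℂ)} (hD : ConjInvariant D)
    (hΩ : IsOpen (circularSet D)) : IsOpen (offReal D) :=
  isOpen_of_isOpen_circularSet hD.offReal (isOpen_circularSet_offReal hΩ)

/-- The index `h` lies in `symmDiff H K` exactly when it lies in one of the two sets, so the
parities multiply correctly. -/
lemma tensorMul_sign {n : ℕ} (h : Fin n) {u u' v v' : Finset (Fin n) → ℍ}
    (hu : ∀ K, u' K = if h ∈ K then -u K else u K) (hv : ∀ K, v' K = if h ∈ K then -v K else v K)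
    (L : Finset (Fin n)) :
    tensorMul u' v' L = if h ∈ L then -tensorMul u v L else tensorMul u v L := by
  have e : tensorMul u' v' L = (if h ∈ L then (-1 : ℝ) else 1) • tensorMul u v L := by
    simp only [tensorMul_apply_eq, Finset.smul_sum]
    refine Finset.sum_congr rfl fun H _ => Finset.sum_congr rfl fun K _ => ?_
    split_ifs with h1 h2 h2
    · have : (h ∈ H ∧ h ∉ K) ∨ (h ∈ K ∧ h ∉ H) := by rwa [← Finset.mem_symmDiff, h1]
      rw [hu, hv]
      rcases this with h4 | h4 <;> simp [h4.1, h4.2]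
    · have : ¬((h ∈ H ∧ h ∉ K) ∨ (h ∈ K ∧ h ∉ H)) := by rwa [← Finset.mem_symmDiff, h1]
      rw [hu, hv]
      by_cases h4 : h ∈ H <;> by_cases h5 : h ∈ K <;> simp_all
    · simp
    · simp
  rw [e]
  split_ifs <;> simp

lemma IsStem.tensorMul {n : ℕ} {D : Set (Fin n → ℂ)} {F G : (Fin n → ℂ) → Finset (Fin n) → ℍ}
    (hF : IsStem D F) (hG : IsStem D G) : IsStem D fun z => tensorMul (F z) (G z) :=
  fun z hz K h => tensorMul_sign h (fun K => hF z hz K h) (fun K => hG z hz K h) K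

lemma thetaCR_isInduced {n : ℕ} {D : Set (Fin n → ℂ)} (hD : ConjInvariant D)
    (hΩ : IsOpen (circularSet D)) {F : (Fin n → ℂ) → Finset (Fin n) → ℍ}
    (hFs : IsStem (offReal D) F) (hF : ∀ z ∈ offReal D, StemDiffAt F z) {f : (Fin n → ℍ) → ℍ}
    (hf : IsInduced (offReal D) F f) (ε : ℝ) (m : Fin n) :
    IsStem (offReal D) (stemCR ε m F) ∧ IsInduced (offReal D) (stemCR ε m F) (thetaCR ε m f) ∧
      Set.EqOn (thetaCR ε m f) (induce (stemCR ε m F)) (circularSet (offReal D)) := by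
  have hs := hFs.stemCR hD.offReal (isOpen_offReal hD hΩ) hF ε m
  have he := thetaCR_eqOn (isOpen_circularSet_offReal hΩ) (fun x hx => im_ne_zero_of_mem hx)
    (fun x hx => hF _ (complexCoord_mem hD.offReal hx)) (hf.eqOn hD.offReal) ε m
  exact ⟨hs, isInduced_of_eqOn hD.offReal hs he, he⟩

lemma thetaCR_comm {n : ℕ} {D : Set (Fin n → ℂ)} (hD : ConjInvariant D)
    (hΩ : IsOpen (circularSet D)) {F : (Fin n → ℂ) → Finset (Fin n) → ℍ}
    (hFs : IsStem (offReal D) F) (hF : ∀ L, ContDiffOn ℝ 2 (fun z => F z L) (offReal D))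
    {f : (Fin n → ℍ) → ℍ} (hf : IsInduced (offReal D) F f) (ε δ : ℝ) (l m : Fin n)
    {x : Fin n → ℍ} (hx : x ∈ circularSet (offReal D)) :
    thetaCR ε l (thetaCR δ m f) x = thetaCR δ m (thetaCR ε l f) x := by
  have hDo := isOpen_offReal hD hΩ
  have hF1 : ∀ z ∈ offReal D, StemDiffAt F z := fun z hz =>
    stemDiffAt_of_contDiffOn hDo (fun L => (hF L).of_le one_le_two) hz
  have key : ∀ (ε δ : ℝ) (l m : Fin n), thetaCR ε l (thetaCR δ m f) x =
      induce (stemCR ε l (stemCR δ m F)) x := by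
    intro ε δ l m
    have h1 := thetaCR_isInduced hD hΩ hFs hF1 hf δ m
    -- The first operator returns a slice function with stem `stemCR δ m F`, so the same result
    -- applies to it again; this costs the second derivative of `F`.
    exact (thetaCR_isInduced hD hΩ h1.1 (fun z hz => stemDiffAt_stemCR hDo hF hz δ m)
      h1.2.1 ε l).2.2 hx
  rw [key, key]
  unfold induce
  rw [stemCR_comm hDo hF (complexCoord_mem hD.offReal hx)]

/-- The products on the right are formed on `offReal D`, where the derivatives are slice functions.
Uniqueness of stems identifies the chosen `stemOf` of each factor with the computed one. -/
lemma thetaCR_sliceMul {n : ℕ} {D : Set (Fin n → ℂ)} (hD : ConjInvariant D)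
    (hΩ : IsOpen (circularSet D)) {f g : (Fin n → ℍ) → ℍ} (hf : IsSlice D f) (hg : IsSlice D g)
    (hF : ∀ z ∈ offReal D, StemDiffAt (stemOf D f) z)
    (hG : ∀ z ∈ offReal D, StemDiffAt (stemOf D g) z) (ε : ℝ) (m : Fin n)
    {x : Fin n → ℍ} (hx : x ∈ circularSet (offReal D)) :
    thetaCR ε m (sliceMul D f g) x =
      sliceMul (offReal D) (thetaCR ε m f) g x + sliceMul (offReal D) f (thetaCR ε m g) x := by
  have hsub := offReal_subset D
  have hfs := hf.isStem_stemOf.mono hsub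
  have hgs := hg.isStem_stemOf.mono hsub
  have hfi := hf.isInduced_stemOf.mono hsub
  have hgi := hg.isInduced_stemOf.mono hsub
  have h1 := thetaCR_isInduced hD hΩ hfs hF hfi ε m
  have h2 := thetaCR_isInduced hD hΩ hgs hG hgi ε m
  have hm := hfs.tensorMul hgs
  have h3 := thetaCR_isInduced hD hΩ hm (fun z hz => (hF z hz).tensorMul (hG z hz))
    (isInduced_induce hD.offReal hm) ε m
  have hz := complexCoord_mem hD.offReal hx
  refine (h3.2.2 hx).trans ?_
  change evalAt _ _ = evalAt _ _ + evalAt _ _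
  beta_reduce
  rw [stemCR_tensorMul (hF _ hz) (hG _ hz), evalAt_add, stemOf_eq h1.1 h1.2.1 hz,
    stemOf_eq h2.1 h2.2.1 hz, stemOf_eq hfs hfi hz, stemOf_eq hgs hgi hz]

end

end SliceWirtinger

/-! ### The three statements of the theorem. -/

theorem mainTheorem2 (n : ℕ) (D : Set (Fin n → ℂ)) (hD : SliceWirtinger.ConjInvariant D)
    (hΩ : IsOpen (SliceWirtinger.circularSet D)) :
    -- the Wirtinger operators are the slice partial derivatives
    (∀ f : (Fin n → ℍ) → ℍ, SliceWirtinger.IsSlice D f →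
      ContDiffOn ℝ n f (SliceWirtinger.circularSet D \ SliceWirtinger.realLocus n) →
      (∀ K, ContDiffOn ℝ n (fun z => SliceWirtinger.stemOf D f z K) (SliceWirtinger.offReal D)) ∧
      ∀ m : Fin n,
        Set.EqOn (SliceWirtinger.theta m f) (SliceWirtinger.slicePartial D m f)
          (SliceWirtinger.circularSet D \ SliceWirtinger.realLocus n) ∧
        Set.EqOn (SliceWirtinger.thetaBar m f) (SliceWirtinger.slicePartialConj D m f)
          (SliceWirtinger.circularSet D \ SliceWirtinger.realLocus n) ∧
        SliceWirtinger.IsSlice (SliceWirtinger.offReal D) (SliceWirtinger.theta m f) ∧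
        SliceWirtinger.IsSlice (SliceWirtinger.offReal D) (SliceWirtinger.thetaBar m f) ∧
        ContinuousOn (SliceWirtinger.theta m f)
          (SliceWirtinger.circularSet D \ SliceWirtinger.realLocus n) ∧
        ContinuousOn (SliceWirtinger.thetaBar m f)
          (SliceWirtinger.circularSet D \ SliceWirtinger.realLocus n)) ∧
    -- the Wirtinger operators commute with each other
    (∀ f : (Fin n → ℍ) → ℍ, SliceWirtinger.IsSlice D f →
      ContDiffOn ℝ (max n 2 : ℕ) f
        (SliceWirtinger.circularSet D \ SliceWirtinger.realLocus n) →
      ∀ l m : Fin n, ∀ x ∈ SliceWirtinger.circularSet D \ SliceWirtinger.realLocus n,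
        SliceWirtinger.theta l (SliceWirtinger.theta m f) x =
          SliceWirtinger.theta m (SliceWirtinger.theta l f) x ∧
        SliceWirtinger.theta l (SliceWirtinger.thetaBar m f) x =
          SliceWirtinger.thetaBar m (SliceWirtinger.theta l f) x ∧
        SliceWirtinger.thetaBar l (SliceWirtinger.thetaBar m f) x =
          SliceWirtinger.thetaBar m (SliceWirtinger.thetaBar l f) x) ∧
    -- Leibniz rules
    (∀ f g : (Fin n → ℍ) → ℍ, SliceWirtinger.IsSlice D f → SliceWirtinger.IsSlice D g →
      ContDiffOn ℝ n f (SliceWirtinger.circularSet D \ SliceWirtinger.realLocus n) →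
      ContDiffOn ℝ n g (SliceWirtinger.circularSet D \ SliceWirtinger.realLocus n) →
      ∀ m : Fin n, ∀ x ∈ SliceWirtinger.circularSet D \ SliceWirtinger.realLocus n,
        SliceWirtinger.theta m (SliceWirtinger.sliceMul D f g) x =
          SliceWirtinger.sliceMul (SliceWirtinger.offReal D) (SliceWirtinger.theta m f) g x +
          SliceWirtinger.sliceMul (SliceWirtinger.offReal D) f (SliceWirtinger.theta m g) x ∧
        SliceWirtinger.thetaBar m (SliceWirtinger.sliceMul D f g) x =
          SliceWirtinger.sliceMul (SliceWirtinger.offReal D) (SliceWirtinger.thetaBar m f) g x +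
          SliceWirtinger.sliceMul (SliceWirtinger.offReal D) f
            (SliceWirtinger.thetaBar m g) x) := by
  have hsub := SliceWirtinger.offReal_subset D
  have hDo := SliceWirtinger.isOpen_offReal hD hΩ
  simp only [← SliceWirtinger.circularSet_offReal, SliceWirtinger.theta_eq,
    SliceWirtinger.thetaBar_eq, SliceWirtinger.slicePartial, SliceWirtinger.slicePartialConj,
    SliceWirtinger.stemDel_eq, SliceWirtinger.stemDelBar_eq]
  refine ⟨fun f hf hc => ?_, fun f hf hc l m x hx => ?_, fun f g hf hg hcf hcg m x hx => ?_⟩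
  · have hs := hf.isStem_stemOf.mono hsub
    have hi := hf.isInduced_stemOf.mono hsub
    have hF := hi.contDiffOn_stem hc
    refine ⟨hF, fun m => ?_⟩
    have hF1 : ∀ L, ContDiffOn ℝ 1 (fun z => SliceWirtinger.stemOf D f z L)
        (SliceWirtinger.offReal D) := fun L =>
      -- The existence of `m : Fin n` forces `n ≥ 1`, so class `C^n` includes class `C^1`.
      (hF L).of_le (by exact_mod_cast (Nat.one_le_iff_ne_zero.2 fun h => by subst h; exact m.elim0))
    have hd := fun z hz => SliceWirtinger.stemDiffAt_of_contDiffOn (z := z) hDo hF1 hz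
    have key := fun ε => SliceWirtinger.thetaCR_isInduced hD hΩ hs hd hi ε m
    have hcont : ∀ ε, ContinuousOn (SliceWirtinger.thetaCR ε m f)
        (SliceWirtinger.circularSet (SliceWirtinger.offReal D)) := fun ε =>
      (SliceWirtinger.continuousOn_induce hD.offReal hDo (fun z hz => hz.2)
        (SliceWirtinger.continuousOn_stemCR hDo hF1 ε m)).congr (key ε).2.2
    exact ⟨(key 1).2.2, (key (-1)).2.2, ⟨_, (key 1).1, (key 1).2.1⟩,
      ⟨_, (key (-1)).1, (key (-1)).2.1⟩,
      hcont 1, hcont (-1)⟩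
  · have hi := hf.isInduced_stemOf.mono hsub
    have hF2 : ∀ L, ContDiffOn ℝ 2 (fun z => SliceWirtinger.stemOf D f z L)
        (SliceWirtinger.offReal D) := fun L =>
      (hi.contDiffOn_stem hc L).of_le (by exact_mod_cast le_max_right n 2)
    have key := fun ε δ => SliceWirtinger.thetaCR_comm hD hΩ (hf.isStem_stemOf.mono hsub) hF2 hi
      ε δ l m hx
    exact ⟨key 1 1, key 1 (-1), key (-1) (-1)⟩
  · have hd : ∀ h : (Fin n → ℍ) → ℍ, SliceWirtinger.IsSlice D h →
        ContDiffOn ℝ n h (SliceWirtinger.circularSet (SliceWirtinger.offReal D)) →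
        ∀ z ∈ SliceWirtinger.offReal D, SliceWirtinger.StemDiffAt (SliceWirtinger.stemOf D h) z :=
      fun h hh hc z hz => SliceWirtinger.stemDiffAt_of_contDiffOn hDo (fun L =>
        ((hh.isInduced_stemOf.mono hsub).contDiffOn_stem hc L).of_le
          (by exact_mod_cast (Nat.one_le_iff_ne_zero.2 fun h => by subst h; exact m.elim0))) hz
    have key := fun ε => SliceWirtinger.thetaCR_sliceMul hD hΩ hf hg (hd f hf hcf) (hd g hg hcg)
      ε m hx
    exact ⟨key 1, key (-1)⟩
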